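/- Let $n\ge 0$ and let $M$ be a smooth manifold of dimension $2n+1$ with a smooth Riemannian metric $g$, Levi-Civita connection $\nabla$, curvature $R_{X,Y}=[\nabla_X,\nabla_Y]-\nabla_{[X,Y]}$, Ricci tensor $\operatorname{Ric}(X,Y)=\operatorname{trace}\{Z\mapsto R_{Z,X}Y\}$ and scalar curvature $r=\operatorname{trace}_g\operatorname{Ric}$. Let $(f,Q,\xi,\eta,g)$ be a weak almost contact metric structure on $M$: $f$ is a smooth $(1,1)$-tensor of rank $2n$, $Q$ a smooth nonsingular $(1,1)$-tensor, $\xi$ a smooth vector field, $\eta$ a smooth 1-form, $\ker\eta$ is $f$-invariant, and $$f^2=-Q+\eta\otimes\xi,\quad \eta(\xi)=1,\quad Q\xi=\xi,\quad g(fX,fY)=g(X,QY)-\eta(X)\eta(Y).$$ Assume that it is weak $\beta$-Kenmotsu with a real constant $\beta\neq0$, i.e. $$(\nabla_Xf)Y=\beta\{g(fX,Y)\,\xi-\eta(Y)\,fX\}\quad\text{for all vector fields } X,Y,$$ and $\eta$-Einstein, i.e. $\operatorname{Ric}=a\,g+b\,\eta\otimes\eta$ for some smooth functions $a,b$ on $M$.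 Define the $\ast$-Ricci tensor by $\operatorname{Ric}^\ast(X,Y)=\tfrac12\operatorname{trace}\{Z\mapsto f\,R_{X,fY}Z\}$. If $(g,V)$ is a $\ast$-$\eta$-Ricci soliton, i.e. $V$ is a smooth vector field and $$\tfrac12\,\pounds_Vg+\operatorname{Ric}^\ast=\lambda\,g+\mu\,\eta\otimes\eta$$ for some constants $\lambda,\mu\in\mathbb R$, then $(M,g)$ is an Einstein manifold (that is, $\operatorname{Ric}=c\,g$ for a real constant $c$) and its scalar curvature is $r=-2n(2n+1)\beta^2$. -/

import Mathlib

open Bundle VectorField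
open scoped Manifold ContDiff Topology

section WeakKenmotsu

set_option linter.unusedSectionVars false

variable {E : Type*} [NormedAddCommGroup E] [NormedSpace ℝ E] [FiniteDimensional ℝ E]
  {M : Type*} [TopologicalSpace M] [ChartedSpace E M] [IsManifold 𝓘(ℝ, E) ∞ M]

/-- A smooth Riemannian metric on `M`. -/
abbrev SmoothMetric (E : Type*) [NormedAddCommGroup E] [NormedSpace ℝ E]
    (M : Type*) [TopologicalSpace M] [ChartedSpace E M] [IsManifold 𝓘(ℝ, E) ∞ M] :=
  ContMDiffRiemannianMetric 𝓘(ℝ, E) ∞ E (fun x : M ↦ TangentSpace 𝓘(ℝ, E) x)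

/-- A vector field on `M`, not necessarily smooth. -/
abbrev VField (E : Type*) [NormedAddCommGroup E] [NormedSpace ℝ E]
    (M : Type*) [TopologicalSpace M] [ChartedSpace E M] :=
  (x : M) → TangentSpace 𝓘(ℝ, E) x

namespace SmoothMetric

/-- The function `g(Y, Z)`. -/
noncomputable def pair (g : SmoothMetric E M) (Y Z : VField E M) (x : M) : ℝ := g.inner x (Y x) (Z x)

theorem mdifferentiableAt_pair (g : SmoothMetric E M) {Y Z : VField E M} {x : M}
    (hY : MDiffAt (T% Y) x) (hZ : MDiffAt (T% Z) x) : MDiffAt (g.pair Y Z) x := by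
  have h := MDifferentiableAt.clm_bundle_apply₂ (F₁ := E) (F₂ := E) (F₃ := ℝ)
    (E₁ := fun x : M ↦ TangentSpace 𝓘(ℝ, E) x) (E₂ := fun x : M ↦ TangentSpace 𝓘(ℝ, E) x)
    (E₃ := Bundle.Trivial M ℝ) (b := fun y : M ↦ y)
    ((g.contMDiff x).mdifferentiableAt (by simp)) hY hZ
  rw [mdifferentiableAt_totalSpace] at h
  exact h.2

theorem contMDiffAt_pair (g : SmoothMetric E M) {Y Z : VField E M} {x : M}
    (hY : CMDiffAt ∞ (T% Y) x) (hZ : CMDiffAt ∞ (T% Z) x) : CMDiffAt ∞ (g.pair Y Z) x := by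
  have h := ContMDiffAt.clm_bundle_apply₂ (F₁ := E) (F₂ := E) (F₃ := ℝ)
    (E₁ := fun x : M ↦ TangentSpace 𝓘(ℝ, E) x) (E₂ := fun x : M ↦ TangentSpace 𝓘(ℝ, E) x)
    (E₃ := Bundle.Trivial M ℝ) (b := fun y : M ↦ y)
    (g.contMDiff x) hY hZ
  rw [contMDiffAt_totalSpace] at h
  exact h.2

/-- The right-hand side of the Koszul formula `2 g(∇_X Y, Z) = ...`. -/
noncomputable def koszul (g : SmoothMetric E M) (X Y Z : VField E M) (x : M) : ℝ :=
  d% (g.pair Y Z) x (X x) + d% (g.pair X Z) x (Y x) - d% (g.pair X Y) x (Z x)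
    + g.inner x (mlieBracket 𝓘(ℝ, E) X Y x) (Z x)
    - g.inner x (mlieBracket 𝓘(ℝ, E) X Z x) (Y x)
    - g.inner x (mlieBracket 𝓘(ℝ, E) Y Z x) (X x)

theorem koszul_smul_left (g : SmoothMetric E M) {X Y Z : VField E M} {x : M} {f : M → ℝ}
    (hf : MDiffAt f x)
    (hX : MDiffAt (T% X) x) (hY : MDiffAt (T% Y) x) (hZ : MDiffAt (T% Z) x) :
    g.koszul (f • X) Y Z x = f x • g.koszul X Y Z x := by
  have h1 : g.pair (f • X) Z = f * g.pair X Z := by ext y; simp [pair]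
  have h2 : g.pair (f • X) Y = f * g.pair X Y := by ext y; simp [pair]
  simp only [koszul, h1, h2]
  rw [mvfderiv_mul hf (g.mdifferentiableAt_pair hX hZ),
    mvfderiv_mul hf (g.mdifferentiableAt_pair hX hY),
    mlieBracket_smul_left hf hX, mlieBracket_smul_left hf hX]
  simp [pair, g.symm x (mlieBracket 𝓘(ℝ, E) Y Z x)]
  ring

theorem koszul_smul_right (g : SmoothMetric E M) {X Y Z : VField E M} {x : M} {f : M → ℝ}
    (hf : MDiffAt f x)
    (hX : MDiffAt (T% X) x) (hY : MDiffAt (T% Y) x) (hZ : MDiffAt (T% Z) x) :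
    g.koszul X Y (f • Z) x = f x • g.koszul X Y Z x := by
  have h1 : g.pair X (f • Z) = f * g.pair X Z := by ext y; simp [pair]
  have h2 : g.pair Y (f • Z) = f * g.pair Y Z := by ext y; simp [pair]
  simp only [koszul, h1, h2]
  rw [mvfderiv_mul hf (g.mdifferentiableAt_pair hX hZ),
    mvfderiv_mul hf (g.mdifferentiableAt_pair hY hZ),
    mlieBracket_smul_right hf hZ, mlieBracket_smul_right hf hZ]
  simp [pair, g.symm x (Z x)]
  ring

theorem koszul_smul_mid (g : SmoothMetric E M) {X Y Z : VField E M} {x : M} {f : M → ℝ}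
    (hf : MDiffAt f x)
    (hX : MDiffAt (T% X) x) (hY : MDiffAt (T% Y) x) (hZ : MDiffAt (T% Z) x) :
    g.koszul X (f • Y) Z x =
      f x * g.koszul X Y Z x + 2 * d% f x (X x) * g.inner x (Y x) (Z x) := by
  have h1 : g.pair X (f • Y) = f * g.pair X Y := by ext y; simp [pair]
  have h2 : g.pair (f • Y) Z = f * g.pair Y Z := by ext y; simp [pair]
  simp only [koszul, h1, h2]
  rw [mvfderiv_mul hf (g.mdifferentiableAt_pair hX hY),
    mvfderiv_mul hf (g.mdifferentiableAt_pair hY hZ),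
    mlieBracket_smul_left hf hY, mlieBracket_smul_right hf hY]
  simp [pair, g.symm x (Y x) (X x)]
  ring

theorem koszul_add_left (g : SmoothMetric E M) {X X' Y Z : VField E M} {x : M}
    (hX : MDiffAt (T% X) x) (hX' : MDiffAt (T% X') x)
    (hY : MDiffAt (T% Y) x) (hZ : MDiffAt (T% Z) x) :
    g.koszul (X + X') Y Z x = g.koszul X Y Z x + g.koszul X' Y Z x := by
  have h1 : g.pair (X + X') Z = g.pair X Z + g.pair X' Z := by ext y; simp [pair]
  have h2 : g.pair (X + X') Y = g.pair X Y + g.pair X' Y := by ext y; simp [pair]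
  simp only [koszul, h1, h2]
  rw [mvfderiv_add (g.mdifferentiableAt_pair hX hZ) (g.mdifferentiableAt_pair hX' hZ),
    mvfderiv_add (g.mdifferentiableAt_pair hX hY) (g.mdifferentiableAt_pair hX' hY),
    mlieBracket_add_left hX hX', mlieBracket_add_left hX hX']
  simp
  ring

theorem koszul_add_right (g : SmoothMetric E M) {X Y Z Z' : VField E M} {x : M}
    (hX : MDiffAt (T% X) x)
    (hY : MDiffAt (T% Y) x) (hZ : MDiffAt (T% Z) x) (hZ' : MDiffAt (T% Z') x) :
    g.koszul X Y (Z + Z') x = g.koszul X Y Z x + g.koszul X Y Z' x := by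
  have h1 : g.pair X (Z + Z') = g.pair X Z + g.pair X Z' := by ext y; simp [pair]
  have h2 : g.pair Y (Z + Z') = g.pair Y Z + g.pair Y Z' := by ext y; simp [pair]
  simp only [koszul, h1, h2]
  rw [mvfderiv_add (g.mdifferentiableAt_pair hX hZ) (g.mdifferentiableAt_pair hX hZ'),
    mvfderiv_add (g.mdifferentiableAt_pair hY hZ) (g.mdifferentiableAt_pair hY hZ'),
    mlieBracket_add_right hZ hZ', mlieBracket_add_right hZ hZ']
  simp
  ring

theorem koszul_add_mid (g : SmoothMetric E M) {X Y Y' Z : VField E M} {x : M}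
    (hX : MDiffAt (T% X) x)
    (hY : MDiffAt (T% Y) x) (hY' : MDiffAt (T% Y') x) (hZ : MDiffAt (T% Z) x) :
    g.koszul X (Y + Y') Z x = g.koszul X Y Z x + g.koszul X Y' Z x := by
  have h1 : g.pair X (Y + Y') = g.pair X Y + g.pair X Y' := by ext y; simp [pair]
  have h2 : g.pair (Y + Y') Z = g.pair Y Z + g.pair Y' Z := by ext y; simp [pair]
  simp only [koszul, h1, h2]
  rw [mvfderiv_add (g.mdifferentiableAt_pair hX hY) (g.mdifferentiableAt_pair hX hY'),
    mvfderiv_add (g.mdifferentiableAt_pair hY hZ) (g.mdifferentiableAt_pair hY' hZ),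
    mlieBracket_add_left hY hY', mlieBracket_add_right hY hY']
  simp
  ring

/-- The isomorphism `u ↦ g(u, ·)` from the tangent space to its dual. -/
noncomputable def flat (g : SmoothMetric E M) (x : M) :
    TangentSpace 𝓘(ℝ, E) x ≃ₗ[ℝ] (TangentSpace 𝓘(ℝ, E) x →L[ℝ] ℝ) :=
  have : FiniteDimensional ℝ (TangentSpace 𝓘(ℝ, E) x) := inferInstanceAs (FiniteDimensional ℝ E)
  LinearMap.linearEquivOfInjective (g.inner x : TangentSpace 𝓘(ℝ, E) x →ₗ[ℝ] _)
    (by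
      refine (injective_iff_map_eq_zero _).2 fun u hu ↦ ?_
      by_contra h
      have h1 := g.pos x u h
      have h2 : g.inner x u = 0 := hu
      rw [h2] at h1
      simp at h1)
    ((Subspace.dual_finrank_eq (K := ℝ) (V := E)).symm.trans
      (LinearMap.toContinuousLinearMap (𝕜 := ℝ) (E := E) (F' := ℝ)).finrank_eq)

theorem flat_apply (g : SmoothMetric E M) (x : M) (u v : TangentSpace 𝓘(ℝ, E) x) :
    g.flat x u v = g.inner x u v := rfl

theorem inner_flat_symm (g : SmoothMetric E M) (x : M) (φ : TangentSpace 𝓘(ℝ, E) x →L[ℝ] ℝ)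
    (v : TangentSpace 𝓘(ℝ, E) x) : g.inner x ((g.flat x).symm φ) v = φ v := by
  rw [← flat_apply, LinearEquiv.apply_symm_apply]

theorem ext_inner (g : SmoothMetric E M) {x : M} {u v : TangentSpace 𝓘(ℝ, E) x}
    (h : ∀ Z : VField E M, MDiffAt (T% Z) x → g.inner x u (Z x) = g.inner x v (Z x)) : u = v := by
  apply (g.flat x).injective
  ext z
  simpa [flat_apply] using h (FiberBundle.extend E z) (FiberBundle.mdifferentiableAt_extend ..)

/-- The tensor `(X, Z) ↦ g(∇_X Y, Z)` given by the Koszul formula. -/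
noncomputable def koszulHom (g : SmoothMetric E M) (Y : VField E M) (x : M)
    (hY : MDiffAt (T% Y) x) :
    TangentSpace 𝓘(ℝ, E) x →L[ℝ] TangentSpace 𝓘(ℝ, E) x →L[ℝ] ℝ :=
  (1 / 2 : ℝ) • TensorialAt.mkHom₂ (I := 𝓘(ℝ, E)) (F := E) (F' := E)
    (fun X Z : VField E M ↦ g.koszul X Y Z x) x
    (fun _ hZ ↦ ⟨fun hf hX ↦ g.koszul_smul_left hf hX hY hZ,
      fun hX hX' ↦ g.koszul_add_left hX hX' hY hZ⟩)
    (fun _ hX ↦ ⟨fun hf hZ ↦ g.koszul_smul_right hf hX hY hZ,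
      fun hZ hZ' ↦ g.koszul_add_right hX hY hZ hZ'⟩)

theorem koszulHom_apply (g : SmoothMetric E M) {X Y Z : VField E M} {x : M}
    (hX : MDiffAt (T% X) x) (hY : MDiffAt (T% Y) x) (hZ : MDiffAt (T% Z) x) :
    g.koszulHom Y x hY (X x) (Z x) = (1 / 2) * g.koszul X Y Z x := by
  unfold koszulHom
  have := TensorialAt.mkHom₂_apply (I := 𝓘(ℝ, E)) (F := E) (F' := E)
    (Φ := fun X Z : VField E M ↦ g.koszul X Y Z x) (x := x)
    (fun _ hZ ↦ ⟨fun hf hX ↦ g.koszul_smul_left hf hX hY hZ,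
      fun hX hX' ↦ g.koszul_add_left hX hX' hY hZ⟩)
    (fun _ hX ↦ ⟨fun hf hZ ↦ g.koszul_smul_right hf hX hY hZ,
      fun hZ hZ' ↦ g.koszul_add_right hX hY hZ hZ'⟩) hX hZ
  simp only [smul_apply, smul_eq_mul]
  rw [this]

open Classical in
/-- The underlying function of the Levi-Civita connection. -/
noncomputable def nablaFun (g : SmoothMetric E M) (Y : VField E M) (x : M) :
    TangentSpace 𝓘(ℝ, E) x →L[ℝ] TangentSpace 𝓘(ℝ, E) x :=
  if hY : MDiffAt (T% Y) x then
    have : FiniteDimensional ℝ (TangentSpace 𝓘(ℝ, E) x) := inferInstanceAs (FiniteDimensional ℝ E)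
    have : T2Space (TangentSpace 𝓘(ℝ, E) x) := inferInstanceAs (T2Space E)
    LinearMap.toContinuousLinearMap ((g.flat x).symm.toLinearMap ∘ₗ
      (g.koszulHom Y x hY : TangentSpace 𝓘(ℝ, E) x →ₗ[ℝ] _))
  else 0

theorem inner_nablaFun (g : SmoothMetric E M) {X Y Z : VField E M} {x : M}
    (hX : MDiffAt (T% X) x) (hY : MDiffAt (T% Y) x) (hZ : MDiffAt (T% Z) x) :
    g.inner x (g.nablaFun Y x (X x)) (Z x) = (1 / 2) * g.koszul X Y Z x := by
  rw [nablaFun, dif_pos hY, ← g.koszulHom_apply hX hY hZ]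
  exact g.inner_flat_symm x _ _

/-- The Levi-Civita connection of `g`, constructed from the Koszul formula. It is torsion-free and
compatible with `g`, see `leviCivita_torsion` and `leviCivita_metric`. As usual for
`CovariantDerivative`, `g.leviCivita Y x u` is `∇_u Y` at `x`. -/
noncomputable def leviCivita (g : SmoothMetric E M) :
    CovariantDerivative 𝓘(ℝ, E) E (fun x : M ↦ TangentSpace 𝓘(ℝ, E) x) where
  toFun := g.nablaFun
  isCovariantDerivativeOnUniv :=
    { add := by
        intro Y Y' x hY hY' _
        ext v
        have hX := FiberBundle.mdifferentiableAt_extend 𝓘(ℝ, E) E v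
        have hv := FiberBundle.extend_apply_self (F := E) v
        refine g.ext_inner fun Z hZ ↦ ?_
        conv_lhs => rw [← hv]
        conv_rhs => rw [← hv]
        rw [g.inner_nablaFun hX (mdifferentiableAt_add_section hY hY') hZ,
          add_apply, map_add, add_apply,
          g.inner_nablaFun hX hY hZ, g.inner_nablaFun hX hY' hZ,
          g.koszul_add_mid hX hY hY' hZ]
        ring
      leibniz := by
        intro Y f x hY hf _
        ext v
        have hX := FiberBundle.mdifferentiableAt_extend 𝓘(ℝ, E) E v
        have hv := FiberBundle.extend_apply_self (F := E) v
        refine g.ext_inner fun Z hZ ↦ ?_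
        conv_lhs => rw [← hv]
        conv_rhs => rw [← hv]
        rw [g.inner_nablaFun hX (hf.smul_section hY) hZ,
          add_apply, smul_apply, map_add, map_smul,
          add_apply, smul_apply,
          g.inner_nablaFun hX hY hZ, g.koszul_smul_mid hf hX hY hZ,
          ContinuousLinearMap.smulRight_apply, map_smul, smul_apply]
        simp only [smul_eq_mul]
        ring }

theorem inner_leviCivita (g : SmoothMetric E M) {X Y Z : VField E M} {x : M}
    (hX : MDiffAt (T% X) x) (hY : MDiffAt (T% Y) x) (hZ : MDiffAt (T% Z) x) :
    g.inner x (g.leviCivita Y x (X x)) (Z x) = (1 / 2) * g.koszul X Y Z x :=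
  g.inner_nablaFun hX hY hZ

/-- The Levi-Civita connection is torsion-free. -/
theorem leviCivita_torsion (g : SmoothMetric E M) : g.leviCivita.torsion = 0 := by
  rw [CovariantDerivative.torsion_eq_zero_iff]
  intro X Y x hX hY
  refine g.ext_inner fun Z hZ ↦ ?_
  rw [map_sub, sub_apply, g.inner_leviCivita hX hY hZ,
    g.inner_leviCivita hY hX hZ]
  have h : g.pair X Y = g.pair Y X := by ext y; exact g.symm y _ _
  rw [koszul, koszul, h, mlieBracket_swap_apply (V := Y) (W := X), map_neg,
    neg_apply]
  ring

/-- The Levi-Civita connection is compatible with the metric. -/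
theorem leviCivita_metric (g : SmoothMetric E M) {X Y Z : VField E M} {x : M}
    (hX : MDiffAt (T% X) x) (hY : MDiffAt (T% Y) x) (hZ : MDiffAt (T% Z) x) :
    d% (g.pair Y Z) x (X x) =
      g.inner x (g.leviCivita Y x (X x)) (Z x) + g.inner x (Y x) (g.leviCivita Z x (X x)) := by
  rw [g.symm x (Y x), g.inner_leviCivita hX hY hZ, g.inner_leviCivita hX hZ hY]
  have h : g.pair Z Y = g.pair Y Z := by ext y; exact g.symm y _ _
  rw [koszul, koszul, h, mlieBracket_swap_apply (V := Z) (W := Y), map_neg,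
    neg_apply]
  ring


theorem contMDiffAt_mvfderiv {h : M → ℝ} {X : VField E M} {x : M}
    (hh : CMDiffAt ∞ h x) (hX : CMDiffAt ∞ (T% X) x) :
    CMDiffAt ∞ (fun y ↦ d% h y (X y)) x := by
  have h1 := hh.mfderiv_const (m := ∞) (by simp)
  have h2 := ContMDiffAt.clm_apply_of_inCoordinates (F₁ := E) (F₂ := ℝ)
    (E₁ := fun x : M ↦ TangentSpace 𝓘(ℝ, E) x) (E₂ := fun x : ℝ ↦ TangentSpace 𝓘(ℝ, ℝ) x)
    (b₁ := fun y : M ↦ y) (b₂ := h) (ϕ := fun y ↦ mfderiv% h y) (v := X) h1 hX hh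
  rw [contMDiffAt_totalSpace] at h2
  simpa [mvfderiv] using! h2.2

theorem contMDiffAt_koszul (g : SmoothMetric E M) {X Y Z : VField E M} {x : M}
    (hX : CMDiffAt ∞ (T% X) x) (hY : CMDiffAt ∞ (T% Y) x) (hZ : CMDiffAt ∞ (T% Z) x) :
    CMDiffAt ∞ (g.koszul X Y Z) x := by
  have hb {U W : VField E M} (hU : CMDiffAt ∞ (T% U) x) (hW : CMDiffAt ∞ (T% W) x) :
      CMDiffAt ∞ (T% (mlieBracket 𝓘(ℝ, E) U W)) x :=
    have : IsManifold 𝓘(ℝ, E) (minSmoothness ℝ 2) M := by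
      rw [minSmoothness_of_isRCLikeNormedField]; infer_instance
    have : IsManifold 𝓘(ℝ, E) (((⊤ : ℕ∞) : WithTop ℕ∞) + 1) M := by
      simpa using! (inferInstance : IsManifold 𝓘(ℝ, E) ∞ M)
    ContMDiffAt.mlieBracket_vectorField (m := ⊤) (n := ⊤) hU hW (by simp)
  exact (((((contMDiffAt_mvfderiv (g.contMDiffAt_pair hY hZ) hX).add
    (contMDiffAt_mvfderiv (g.contMDiffAt_pair hX hZ) hY)).sub
    (contMDiffAt_mvfderiv (g.contMDiffAt_pair hX hY) hZ)).add
    (g.contMDiffAt_pair (hb hX hY) hZ)).sub (g.contMDiffAt_pair (hb hX hZ) hY)).sub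
    (g.contMDiffAt_pair (hb hY hZ) hX)

/-- A vector field is smooth at `x` as soon as its products with smooth vector fields are. -/
theorem contMDiffAt_of_pair (g : SmoothMetric E M) {W : VField E M} {x : M}
    (h : ∀ Z : VField E M, CMDiffAt ∞ (T% Z) x → CMDiffAt ∞ (g.pair W Z) x) :
    CMDiffAt ∞ (T% W) x := by
  let t := trivializationAt E (fun x : M ↦ TangentSpace 𝓘(ℝ, E) x) x
  have hxt : x ∈ t.baseSet := FiberBundle.mem_baseSet_trivializationAt' x
  let G : M → E →L[ℝ] E →L[ℝ] ℝ := fun y ↦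
    ContinuousLinearMap.inCoordinates E (fun x : M ↦ TangentSpace 𝓘(ℝ, E) x) (E →L[ℝ] ℝ)
      (fun x : M ↦ TangentSpace 𝓘(ℝ, E) x →L[ℝ] ℝ) x y x y (g.inner y)
  have hG : CMDiffAt ∞ G x := ((contMDiffAt_hom_bundle _).1 (g.contMDiff x)).2
  have hGa {y : M} (hy : y ∈ t.baseSet) (a b : E) :
      G y a b = g.inner y (t.symm y a) (t.symm y b) := by
    have := inCoordinates_apply_eq₂ (F₁ := E) (F₂ := E) (F₃ := ℝ)
      (E₁ := fun x : M ↦ TangentSpace 𝓘(ℝ, E) x) (E₂ := fun x : M ↦ TangentSpace 𝓘(ℝ, E) x)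
      (E₃ := Bundle.Trivial M ℝ) (x₀ := x) (x := y) (ϕ := g.inner y) (v := a) (w := b) hy hy
      (by simp)
    simpa using! this
  let b := Module.finBasis ℝ E
  let φ : M → E →L[ℝ] ℝ := fun y ↦ ∑ i, g.pair W (fun z ↦ t.symm z (b i)) y •
    LinearMap.toContinuousLinearMap (b.coord i)
  have hφ : CMDiffAt ∞ φ x := by
    refine contMDiffAt_finsetSum fun i _ ↦ ContMDiffAt.smul (h _ ?_) contMDiffAt_const
    rw [contMDiffAt_section]
    refine (contMDiffAt_const (c := b i)).congr_of_eventuallyEq ?_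
    filter_upwards [t.open_baseSet.mem_nhds hxt] with y hy
    exact congrArg Prod.snd (t.apply_mk_symm hy (b i))
  have hGφ {y : M} (hy : y ∈ t.baseSet) : G y (t ⟨y, W y⟩).2 = φ y := by
    refine ContinuousLinearMap.coe_inj.1 (b.ext fun i ↦ ?_)
    have h1 : G y (t ⟨y, W y⟩).2 (b i) = g.pair W (fun z ↦ t.symm z (b i)) y := by
      rw [hGa hy, t.symm_apply_apply_mk hy, pair]
    simp [h1, φ, Finsupp.single_apply]
  have hGinj {y : M} (hy : y ∈ t.baseSet) : (G y).IsInvertible := by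
    have hinj : Function.Injective (G y : E →ₗ[ℝ] E →L[ℝ] ℝ) := by
      refine (injective_iff_map_eq_zero _).2 fun u hu ↦ ?_
      have hu' : G y u = 0 := hu
      by_contra hne
      have h0 : t.symm y u ≠ 0 := by
        intro h0
        apply hne
        have := congrArg Prod.snd (t.apply_mk_symm hy u)
        rw [h0] at this
        simpa using! this.symm.trans (congrArg Prod.snd (t.zeroSection ℝ hy))
      have h1 := g.pos y _ h0
      rw [← hGa hy, hu'] at h1
      simp at h1
    refine ⟨(LinearMap.linearEquivOfInjective _ hinj
      ((Subspace.dual_finrank_eq (K := ℝ) (V := E)).symm.trans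
        (LinearMap.toContinuousLinearMap (𝕜 := ℝ) (E := E) (F' := ℝ)).finrank_eq)
      ).toContinuousLinearEquiv, ?_⟩
    ext a b
    rfl
  rw [contMDiffAt_section]
  have hinv : CMDiffAt ∞ (fun y ↦ (G y).inverse (φ y)) x := by
    refine ContMDiffAt.clm_apply ?_ hφ
    exact ((hGinj hxt).contDiffAt_map_inverse.contMDiffAt (n := ∞)).comp x hG
  refine hinv.congr_of_eventuallyEq ?_
  filter_upwards [t.open_baseSet.mem_nhds hxt] with y hy
  rw [← hGφ hy, (hGinj hy).inverse_apply_self]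

theorem contMDiffAt_leviCivita (g : SmoothMetric E M) {X Y : VField E M} {x : M}
    (hX : CMDiffAt ∞ (T% X) x) (hY : CMDiffAt ∞ (T% Y) x) :
    CMDiffAt ∞ (T% (fun y ↦ g.leviCivita Y y (X y))) x := by
  refine g.contMDiffAt_of_pair fun Z hZ ↦ ?_
  refine (contMDiffAt_const (c := (1 / 2 : ℝ)).mul (g.contMDiffAt_koszul hX hY hZ)).congr_of_eventuallyEq ?_
  have e {U : VField E M} (hU : CMDiffAt ∞ (T% U) x) : ∀ᶠ y in 𝓝 x, MDiffAt (T% U) y :=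
    ((contMDiffAt_iff_contMDiffAt_nhds (n := 1) (by simp)).1
      (hU.of_le (n := ∞) (m := 1) (by simp))).mono fun y hy ↦ hy.mdifferentiableAt (by simp)
  filter_upwards [e hX, e hY, e hZ] with y h1 h2 h3
  exact g.inner_leviCivita h1 h2 h3

/-- The curvature `R(X, Y)Z = ∇_X ∇_Y Z - ∇_Y ∇_X Z - ∇_[X, Y] Z` of vector fields. -/
noncomputable def curvatureField (g : SmoothMetric E M) (X Y Z : VField E M) : VField E M :=
  fun x ↦ g.leviCivita (fun y ↦ g.leviCivita Z y (Y y)) x (X x)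
    - g.leviCivita (fun y ↦ g.leviCivita Z y (X y)) x (Y x)
    - g.leviCivita Z x (mlieBracket 𝓘(ℝ, E) X Y x)

/-- A vector field extending the tangent vector `u` at `x`: near `x`, its components in the
preferred coordinates at `x` are constant. -/
noncomputable def localExt {x : M} (u : TangentSpace 𝓘(ℝ, E) x) : VField E M := fun y ↦
  (trivializationAt E (fun x : M ↦ TangentSpace 𝓘(ℝ, E) x) x).symmL ℝ y
    ((trivializationAt E (fun x : M ↦ TangentSpace 𝓘(ℝ, E) x) x).continuousLinearMapAt ℝ x u)

theorem localExt_self {x : M} (u : TangentSpace 𝓘(ℝ, E) x) : localExt u x = u :=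
  Bundle.Trivialization.symmL_continuousLinearMapAt _
    (FiberBundle.mem_baseSet_trivializationAt' x) u

theorem localExt_add {x : M} (u v : TangentSpace 𝓘(ℝ, E) x) :
    localExt (u + v) = localExt u + localExt v := by
  ext y
  simp only [localExt, map_add, Pi.add_apply]

theorem localExt_smul {x : M} (c : ℝ) (u : TangentSpace 𝓘(ℝ, E) x) :
    localExt (c • u) = c • localExt u := by
  ext y
  simp only [localExt, map_smul, Pi.smul_apply]

theorem contMDiffAt_localExt {x : M} (u : TangentSpace 𝓘(ℝ, E) x) :
    CMDiffAt ∞ (T% (localExt u)) x := by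
  let t := trivializationAt E (fun x : M ↦ TangentSpace 𝓘(ℝ, E) x) x
  have hxt : x ∈ t.baseSet := FiberBundle.mem_baseSet_trivializationAt' x
  rw [contMDiffAt_section]
  refine (contMDiffAt_const (c := t.continuousLinearMapAt ℝ x u)).congr_of_eventuallyEq ?_
  filter_upwards [t.open_baseSet.mem_nhds hxt] with y hy
  change (t ⟨y, t.symmL ℝ y (t.continuousLinearMapAt ℝ x u)⟩).2 = _
  rw [t.symmL_apply hy]
  exact congrArg Prod.snd (t.apply_mk_symm hy _)

theorem mdifferentiableAt_leviCivita (g : SmoothMetric E M) {X Y : VField E M} {x : M}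
    (hX : CMDiffAt ∞ (T% X) x) (hY : CMDiffAt ∞ (T% Y) x) :
    MDiffAt (T% (fun y ↦ g.leviCivita Y y (X y))) x :=
  (g.contMDiffAt_leviCivita hX hY).mdifferentiableAt (by simp)

theorem eventually_mdifferentiableAt {X : VField E M} {x : M} (hX : CMDiffAt ∞ (T% X) x) :
    ∀ᶠ y in 𝓝 x, MDiffAt (T% X) y :=
  ((contMDiffAt_iff_contMDiffAt_nhds (n := 1) (by simp)).1
    (hX.of_le (n := ∞) (m := 1) (by simp))).mono fun _ hy ↦ hy.mdifferentiableAt (by simp)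

theorem curvatureField_swap (g : SmoothMetric E M) (X Y Z : VField E M) (x : M) :
    g.curvatureField X Y Z x = - g.curvatureField Y X Z x := by
  simp only [curvatureField]
  rw [mlieBracket_swap_apply (V := X) (W := Y), map_neg]
  abel

theorem curvatureField_add_left (g : SmoothMetric E M) {X X' Y Z : VField E M} {x : M}
    (hX : CMDiffAt ∞ (T% X) x) (hX' : CMDiffAt ∞ (T% X') x)
    (hZ : CMDiffAt ∞ (T% Z) x) :
    g.curvatureField (X + X') Y Z x = g.curvatureField X Y Z x + g.curvatureField X' Y Z x := by
  have h1 : (fun y ↦ g.leviCivita Z y ((X + X') y)) =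
      (fun y ↦ g.leviCivita Z y (X y)) + (fun y ↦ g.leviCivita Z y (X' y)) := by
    ext y; simp
  simp only [curvatureField]
  rw [h1, g.leviCivita.isCovariantDerivativeOnUniv.add (g.mdifferentiableAt_leviCivita hX hZ)
    (g.mdifferentiableAt_leviCivita hX' hZ), mlieBracket_add_left
    (hX.mdifferentiableAt (by simp)) (hX'.mdifferentiableAt (by simp))]
  simp only [Pi.add_apply, map_add, add_apply]
  abel

theorem curvatureField_smul_left (g : SmoothMetric E M) {X Y Z : VField E M} {x : M} (c : ℝ)
    (hX : CMDiffAt ∞ (T% X) x) (hZ : CMDiffAt ∞ (T% Z) x) :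
    g.curvatureField (c • X) Y Z x = c • g.curvatureField X Y Z x := by
  have h1 : (fun y ↦ g.leviCivita Z y ((c • X) y)) =
      c • (fun y ↦ g.leviCivita Z y (X y)) := by
    ext y; simp
  simp only [curvatureField]
  rw [h1, g.leviCivita.isCovariantDerivativeOnUniv.smul_const c
    (g.mdifferentiableAt_leviCivita hX hZ),
    mlieBracket_const_smul_left (hX.mdifferentiableAt (by simp))]
  simp only [Pi.smul_apply, map_smul, smul_apply, smul_sub]

theorem curvatureField_add_right (g : SmoothMetric E M) {X Y Z Z' : VField E M} {x : M}
    (hX : CMDiffAt ∞ (T% X) x) (hY : CMDiffAt ∞ (T% Y) x)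
    (hZ : CMDiffAt ∞ (T% Z) x) (hZ' : CMDiffAt ∞ (T% Z') x) :
    g.curvatureField X Y (Z + Z') x = g.curvatureField X Y Z x + g.curvatureField X Y Z' x := by
  have h1 {U : VField E M} (hU : CMDiffAt ∞ (T% U) x) :
      g.leviCivita (fun y ↦ g.leviCivita (Z + Z') y (U y)) x =
        g.leviCivita (fun y ↦ g.leviCivita Z y (U y)) x +
          g.leviCivita (fun y ↦ g.leviCivita Z' y (U y)) x := by
    rw [← g.leviCivita.isCovariantDerivativeOnUniv.add (g.mdifferentiableAt_leviCivita hU hZ)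
      (g.mdifferentiableAt_leviCivita hU hZ')]
    refine g.leviCivita.isCovariantDerivativeOnUniv.congr_of_eventuallyEq
      (g.mdifferentiableAt_leviCivita hU (hZ.add_section hZ'))
      (mdifferentiableAt_add_section (g.mdifferentiableAt_leviCivita hU hZ)
        (g.mdifferentiableAt_leviCivita hU hZ')) Filter.univ_mem ?_
    filter_upwards [eventually_mdifferentiableAt hZ, eventually_mdifferentiableAt hZ']
      with y h2 h3
    rw [g.leviCivita.isCovariantDerivativeOnUniv.add h2 h3]
    rfl
  simp only [curvatureField]
  rw [h1 hX, h1 hY, g.leviCivita.isCovariantDerivativeOnUniv.add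
    (hZ.mdifferentiableAt (by simp)) (hZ'.mdifferentiableAt (by simp))]
  simp only [add_apply]
  abel

theorem curvatureField_smul_right (g : SmoothMetric E M) {X Y Z : VField E M} {x : M} (c : ℝ)
    (hX : CMDiffAt ∞ (T% X) x) (hY : CMDiffAt ∞ (T% Y) x) (hZ : CMDiffAt ∞ (T% Z) x) :
    g.curvatureField X Y (c • Z) x = c • g.curvatureField X Y Z x := by
  have h1 {U : VField E M} (hU : CMDiffAt ∞ (T% U) x) :
      g.leviCivita (fun y ↦ g.leviCivita (c • Z) y (U y)) x =
        c • g.leviCivita (fun y ↦ g.leviCivita Z y (U y)) x := by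
    rw [← g.leviCivita.isCovariantDerivativeOnUniv.smul_const c
      (g.mdifferentiableAt_leviCivita hU hZ)]
    refine g.leviCivita.isCovariantDerivativeOnUniv.congr_of_eventuallyEq
      (g.mdifferentiableAt_leviCivita hU (hZ.const_smul_section))
      ((mdifferentiableAt_const (c := c)).smul_section (g.mdifferentiableAt_leviCivita hU hZ)) Filter.univ_mem ?_
    filter_upwards [eventually_mdifferentiableAt hZ] with y h2
    rw [g.leviCivita.isCovariantDerivativeOnUniv.smul_const c h2]
    rfl
  simp only [curvatureField]
  rw [h1 hX, h1 hY, g.leviCivita.isCovariantDerivativeOnUniv.smul_const c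
    (hZ.mdifferentiableAt (by simp))]
  simp only [smul_apply, smul_sub]

/-- The curvature tensor at `x`: `curvature g x u v w = R(u, v)w`, computed from local extensions
of the tangent vectors `u`, `v`, `w` to vector fields. -/
noncomputable def curvature (g : SmoothMetric E M) (x : M) :
    TangentSpace 𝓘(ℝ, E) x →ₗ[ℝ] TangentSpace 𝓘(ℝ, E) x →ₗ[ℝ]
      TangentSpace 𝓘(ℝ, E) x →ₗ[ℝ] TangentSpace 𝓘(ℝ, E) x :=
  have hs (u : TangentSpace 𝓘(ℝ, E) x) := contMDiffAt_localExt u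
  LinearMap.mk₂ ℝ
    (fun u v ↦
      { toFun := fun w ↦ g.curvatureField (localExt u) (localExt v)
          (localExt w) x
        map_add' := fun w w' ↦ by
          rw [localExt_add, g.curvatureField_add_right (hs u) (hs v) (hs w) (hs w')]
        map_smul' := fun c w ↦ by
          rw [localExt_smul, g.curvatureField_smul_right c (hs u) (hs v) (hs w), RingHom.id_apply] })
    (fun u u' v ↦ by
      ext w
      change g.curvatureField _ _ _ x = g.curvatureField _ _ _ x + g.curvatureField _ _ _ x
      rw [localExt_add, g.curvatureField_add_left (hs u) (hs u') (hs w)])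
    (fun c u v ↦ by
      ext w
      change g.curvatureField _ _ _ x = c • g.curvatureField _ _ _ x
      rw [localExt_smul, g.curvatureField_smul_left c (hs u) (hs w)])
    (fun u v v' ↦ by
      ext w
      change g.curvatureField _ _ _ x = g.curvatureField _ _ _ x + g.curvatureField _ _ _ x
      rw [g.curvatureField_swap, localExt_add, g.curvatureField_add_left (hs v) (hs v') (hs w),
        neg_add, ← g.curvatureField_swap, ← g.curvatureField_swap])
    (fun c u v ↦ by
      ext w
      change g.curvatureField _ _ _ x = c • g.curvatureField _ _ _ x
      rw [g.curvatureField_swap, localExt_smul, g.curvatureField_smul_left c (hs v) (hs w),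
        ← smul_neg, ← g.curvatureField_swap])

/-- The Ricci tensor `Ric(u, v) = trace (z ↦ R(z, u)v)`. -/
noncomputable def ricci (g : SmoothMetric E M) (x : M) :
    TangentSpace 𝓘(ℝ, E) x →ₗ[ℝ] TangentSpace 𝓘(ℝ, E) x →ₗ[ℝ] ℝ :=
  LinearMap.mk₂ ℝ
    (fun u v ↦ LinearMap.trace ℝ (TangentSpace 𝓘(ℝ, E) x) (((g.curvature x).flip u).flip v))
    (fun u u' v ↦ by
      rw [← map_add]; congr 1; ext w; simp)
    (fun c u v ↦ by
      rw [← map_smul]; congr 1; ext w; simp)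
    (fun u v v' ↦ by rw [map_add, map_add])
    (fun c u v ↦ by rw [map_smul, map_smul])

/-- The `(1,1)` Ricci tensor, defined by `g(Ric♯ u, v) = Ric(u, v)`. -/
noncomputable def ricciSharp (g : SmoothMetric E M) (x : M) :
    TangentSpace 𝓘(ℝ, E) x →ₗ[ℝ] TangentSpace 𝓘(ℝ, E) x :=
  have : FiniteDimensional ℝ (TangentSpace 𝓘(ℝ, E) x) := inferInstanceAs (FiniteDimensional ℝ E)
  have : T2Space (TangentSpace 𝓘(ℝ, E) x) := inferInstanceAs (T2Space E)
  (g.flat x).symm.toLinearMap ∘ₗ LinearMap.toContinuousLinearMap.toLinearMap ∘ₗ g.ricci x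

theorem inner_ricciSharp (g : SmoothMetric E M) (x : M) (u v : TangentSpace 𝓘(ℝ, E) x) :
    g.inner x (g.ricciSharp x u) v = g.ricci x u v :=
  g.inner_flat_symm x _ _

/-- The scalar curvature `r = trace_g Ric = trace Ric♯`. -/
noncomputable def scalarCurvature (g : SmoothMetric E M) (x : M) : ℝ :=
  LinearMap.trace ℝ (TangentSpace 𝓘(ℝ, E) x) (g.ricciSharp x)

/-- `(M, g)` is an Einstein manifold: `Ric = c g` for a constant `c`. -/
def IsEinstein (g : SmoothMetric E M) : Prop :=
  ∃ c : ℝ, ∀ (x : M) (u v : TangentSpace 𝓘(ℝ, E) x), g.ricci x u v = c * g.inner x u v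

/-- The Lie derivative of the metric,
`(£_V g)(X, Y) = V(g(X, Y)) - g([V, X], Y) - g(X, [V, Y])`, evaluated at tangent vectors `u`, `v`
through their local extensions to vector fields. -/
noncomputable def lieDeriv (g : SmoothMetric E M) (V : VField E M) (x : M)
    (u v : TangentSpace 𝓘(ℝ, E) x) : ℝ :=
  d% (g.pair (localExt u) (localExt v)) x (V x)
    - g.inner x (mlieBracket 𝓘(ℝ, E) V (localExt u) x) v
    - g.inner x u (mlieBracket 𝓘(ℝ, E) V (localExt v) x)

end SmoothMetric

/-- A weak almost contact metric structure `(f, Q, ξ, η, g)` on a manifold of dimension `2n + 1`,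
with a given metric `g`. -/
structure WeakAlmostContactMetricStructure (n : ℕ) (g : SmoothMetric E M) where
  f : (x : M) → TangentSpace 𝓘(ℝ, E) x →L[ℝ] TangentSpace 𝓘(ℝ, E) x
  Q : (x : M) → TangentSpace 𝓘(ℝ, E) x →L[ℝ] TangentSpace 𝓘(ℝ, E) x
  ξ : (x : M) → TangentSpace 𝓘(ℝ, E) x
  η : (x : M) → TangentSpace 𝓘(ℝ, E) x →L[ℝ] ℝ
  smooth_f : ContMDiff 𝓘(ℝ, E) (𝓘(ℝ, E).prod 𝓘(ℝ, E →L[ℝ] E)) ∞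
    (fun x ↦ TotalSpace.mk' (E →L[ℝ] E)
      (E := fun x : M ↦ TangentSpace 𝓘(ℝ, E) x →L[ℝ] TangentSpace 𝓘(ℝ, E) x) x (f x))
  smooth_Q : ContMDiff 𝓘(ℝ, E) (𝓘(ℝ, E).prod 𝓘(ℝ, E →L[ℝ] E)) ∞
    (fun x ↦ TotalSpace.mk' (E →L[ℝ] E)
      (E := fun x : M ↦ TangentSpace 𝓘(ℝ, E) x →L[ℝ] TangentSpace 𝓘(ℝ, E) x) x (Q x))
  smooth_ξ : ContMDiff 𝓘(ℝ, E) (𝓘(ℝ, E).prod 𝓘(ℝ, E)) ∞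
    (fun x ↦ TotalSpace.mk' E (E := fun x : M ↦ TangentSpace 𝓘(ℝ, E) x) x (ξ x))
  smooth_η : ContMDiff 𝓘(ℝ, E) (𝓘(ℝ, E).prod 𝓘(ℝ, E →L[ℝ] ℝ)) ∞
    (fun x ↦ TotalSpace.mk' (E →L[ℝ] ℝ)
      (E := fun x : M ↦ TangentSpace 𝓘(ℝ, E) x →L[ℝ] Bundle.Trivial M ℝ x) x (η x))
  /-- `f` has rank `2n` -/
  rank_f : ∀ x, Module.finrank ℝ (LinearMap.range (f x).toLinearMap) = 2 * n
  /-- `Q` is nonsingular -/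
  bijective_Q : ∀ x, Function.Bijective (Q x)
  f_sq : ∀ x u, f x (f x u) = - Q x u + η x u • ξ x
  η_ξ : ∀ x, η x (ξ x) = 1
  Q_ξ : ∀ x, Q x (ξ x) = ξ x
  inner_f : ∀ x u v, g.inner x (f x u) (f x v) = g.inner x u (Q x v) - η x u * η x v
  /-- the distribution `ker η` is `f`-invariant -/
  ker_invariant : ∀ x u, η x u = 0 → η x (f x u) = 0

namespace WeakAlmostContactMetricStructure

variable {n : ℕ} {g : SmoothMetric E M}

/-- The structure is weak `β`-Kenmotsu, for a constant `β ≠ 0`: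
`(∇_X f)Y = β {g(fX, Y) ξ - η(Y) fX}`, where `(∇_X f)Y = ∇_X (fY) - f ∇_X Y`. -/
def IsWeakKenmotsu (S : WeakAlmostContactMetricStructure n g) (β : ℝ) : Prop :=
  β ≠ 0 ∧ ∀ (x : M) (u : TangentSpace 𝓘(ℝ, E) x) (Y : VField E M), MDiffAt (T% Y) x →
    g.leviCivita (fun y ↦ S.f y (Y y)) x u - S.f x (g.leviCivita Y x u) =
      β • (g.inner x (S.f x u) (Y x) • S.ξ x - S.η x (Y x) • S.f x u)

/-- The structure is `η`-Einstein: `Ric = a g + b η ⊗ η` for smooth functions `a`, `b`. -/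
def IsEtaEinstein (S : WeakAlmostContactMetricStructure n g) : Prop :=
  ∃ a b : M → ℝ, CMDiff ∞ a ∧ CMDiff ∞ b ∧ ∀ (x : M) (u v : TangentSpace 𝓘(ℝ, E) x),
    g.ricci x u v = a x * g.inner x u v + b x * (S.η x u * S.η x v)

/-- The `∗`-Ricci tensor `Ric*(u, v) = (1/2) trace (z ↦ f (R(u, f v) z))`. -/
noncomputable def ricciStar (S : WeakAlmostContactMetricStructure n g) (x : M)
    (u v : TangentSpace 𝓘(ℝ, E) x) : ℝ :=
  (1 / 2) * LinearMap.trace ℝ (TangentSpace 𝓘(ℝ, E) x)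
    ((S.f x : TangentSpace 𝓘(ℝ, E) x →ₗ[ℝ] TangentSpace 𝓘(ℝ, E) x) ∘ₗ
      g.curvature x u (S.f x v))

/-- `(g, V)` is a `∗`-`η`-Ricci soliton with constants `l`, `m`:
`(1/2) £_V g + Ric* = l g + m η ⊗ η`. -/
def IsStarEtaRicciSoliton (S : WeakAlmostContactMetricStructure n g) (V : VField E M)
    (l m : ℝ) : Prop :=
  CMDiff ∞ (T% V) ∧ ∀ (x : M) (u v : TangentSpace 𝓘(ℝ, E) x),
    (1 / 2) * g.lieDeriv V x u v + S.ricciStar x u v =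
      l * g.inner x u v + m * (S.η x u * S.η x v)

end WeakAlmostContactMetricStructure
end WeakKenmotsu

/-! Write Φ = g(f·,·), and let Rh(X,Y)Z = R(X,Y)Z + β²(g(Y,Z)X − g(X,Z)Y), the curvature measured
against hyperbolic space. The Kenmotsu condition gives ∇ξ = β(id − η⊗ξ), whence Rh(X,Y)ξ = 0 and
Rh(X,Y) commutes with f. Tracing the first fact, the η-Einstein condition becomes a + b = −2nβ², and
the Ricci contraction of Rh is −b(g − η⊗η). For n = 0 one has η⊗η = g and is done; for n ≥ 1 the
claim is b = 0.

The first Bianchi identity gives tr(f Rh(X,Y)) = −2bΦ(X,Y) (`tr_f_Rh`), so Ric* = −(b + β²)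
g(f·,f·). The second makes bΦ closed, that is θ∧Φ = 0 with θ = db + 2βbη (`θ_wedge`). Hence θ(ξ) = 0
when n ≥ 1, and θ = 0 when n ≥ 2.

The soliton equation now gives £_V g explicitly. A Koszul-type formula yields (£_V∇)(X,ξ), and from
it the Hessian of η(V), whose gradient is called G here (`nabla_gradη`). The Ricci identity computes
Rh(X,Y)G, and its trace (`tr_Rh_gradη`) gives l + m = 0 and, if θ = 0, also bG = 0. Differentiating
bG = 0 once more gives b³|fX|² = 0 (`pow_mul_eq_zero`), so b = 0.

For n = 1 the form θ may survive. There f² = −c on ker η with c constant, the trace identity reads b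
g(G,·) = 2βcθ, and £_V g = 2σ(g − η⊗η) with σ = l + c(b + β²). Lie differentiation of the Ricci
tensor determines V(b) (`der_V_b`). Three differentiations along G then eliminate g(G,V) and η(V)
and leave b⁵|G|⁴ = 0, so bG = 0 again (`mul_gradη_eq_zero`).

The computations take place over an abstract ring of functions. Since b is never inverted, relations
carry powers of b instead of being restricted to the open set b ≠ 0. -/

/-! ### Riemannian calculus over an abstract ring of functions. -/

/-- The algebraic data of Riemannian geometry: a ring `A` (of functions), an `A`-module `𝔛`
(of vector fields) acting on `A` by derivations, a metric with its Levi-Civita connection, and a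
trace of `A`-linear endomorphisms of `𝔛` which is compatible with derivations. -/
structure RiemannianCalculus (A 𝔛 : Type*) [CommRing A] [AddCommGroup 𝔛] [Module A 𝔛] where
  der : 𝔛 →ₗ[A] Derivation ℤ A A
  nabla : 𝔛 →ₗ[A] 𝔛 →+ 𝔛
  g : 𝔛 →ₗ[A] 𝔛 →ₗ[A] A
  grad : A → 𝔛
  tr : (𝔛 →ₗ[A] 𝔛) →ₗ[A] A
  nabla_smul : ∀ X a Y, nabla X (a • Y) = a • nabla X Y + der X a • Y
  g_symm : ∀ X Y, g X Y = g Y X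
  g_ext : ∀ X Y, (∀ Z, g X Z = g Y Z) → X = Y
  der_g : ∀ X Y Z, der X (g Y Z) = g (nabla X Y) Z + g Y (nabla X Z)
  der_comm : ∀ X Y a,
    der X (der Y a) - der Y (der X a) = der (nabla X Y) a - der (nabla Y X) a
  jacobi : ∀ X Y Z,
    nabla X (nabla Y Z - nabla Z Y) - nabla (nabla Y Z - nabla Z Y) X =
      (nabla (nabla X Y - nabla Y X) Z - nabla Z (nabla X Y - nabla Y X)) +
        (nabla Y (nabla X Z - nabla Z X) - nabla (nabla X Z - nabla Z X) Y)
  g_grad : ∀ a X, g (grad a) X = der X a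
  -- Stands in for division by nonzero integers.
  natCast_cancel : ∀ (k : ℕ) (a : A), k ≠ 0 → (k : A) * a = 0 → a = 0
  tr_smulRight : ∀ (θ : 𝔛 →ₗ[A] A) (Z : 𝔛), tr (θ.smulRight Z) = θ Z
  -- Both D = ∇_X and D = £_X obey this Leibniz rule, so one axiom differentiates traces in both
  -- ways.
  tr_der : ∀ (X : 𝔛) (D : 𝔛 →+ 𝔛), (∀ (a : A) Z, D (a • Z) = a • D Z + der X a • Z) →
    ∀ T T' : 𝔛 →ₗ[A] 𝔛, (∀ Z, T' Z = D (T Z) - T (D Z)) → der X (tr T) = tr T'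

namespace RiemannianCalculus

variable {A 𝔛 : Type*} [CommRing A] [AddCommGroup 𝔛] [Module A 𝔛] (L : RiemannianCalculus A 𝔛)

/-- The Lie bracket `[X, Y] = ∇_X Y - ∇_Y X`. -/
def br (X Y : 𝔛) : 𝔛 := L.nabla X Y - L.nabla Y X

theorem two_cancel_eq (L : RiemannianCalculus A 𝔛) {a b : A} (h : 2 * a = 2 * b) : a = b :=
  sub_eq_zero.1 (L.natCast_cancel 2 _ two_ne_zero (by rw [Nat.cast_ofNat, mul_sub, h, sub_self]))

theorem nabla_smul_left (a : A) (X Y : 𝔛) : L.nabla (a • X) Y = a • L.nabla X Y := by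
  rw [map_smul]; rfl

theorem nabla_add_left (X X' Y : 𝔛) : L.nabla (X + X') Y = L.nabla X Y + L.nabla X' Y := by
  rw [map_add]; rfl

theorem nabla_sub_left (X X' Y : 𝔛) : L.nabla (X - X') Y = L.nabla X Y - L.nabla X' Y := by
  rw [map_sub]; rfl

theorem der_smul_left (a : A) (X : 𝔛) (b : A) : L.der (a • X) b = a * L.der X b := by
  rw [map_smul]; rfl

theorem der_add_left (X X' : 𝔛) (b : A) : L.der (X + X') b = L.der X b + L.der X' b := by
  rw [map_add]; rfl

theorem der_sub_left (X X' : 𝔛) (b : A) : L.der (X - X') b = L.der X b - L.der X' b := by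
  rw [map_sub]; rfl

theorem der_mul (X : 𝔛) (a b : A) : L.der X (a * b) = a * L.der X b + b * L.der X a := by
  rw [Derivation.leibniz]; rfl

theorem br_add_right (X Y Z : 𝔛) : L.br X (Y + Z) = L.br X Y + L.br X Z := by
  simp only [br, map_add, AddMonoidHom.add_apply]; abel

theorem br_sub_right (X Y Z : 𝔛) : L.br X (Y - Z) = L.br X Y - L.br X Z := by
  simp only [br, map_sub, AddMonoidHom.sub_apply]; abel

theorem br_smul_right (X : 𝔛) (a : A) (Y : 𝔛) :
    L.br X (a • Y) = a • L.br X Y + L.der X a • Y := by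
  simp only [br, nabla_smul, nabla_smul_left]; module

theorem der_br (X Y : 𝔛) (a : A) :
    L.der (L.br X Y) a = L.der X (L.der Y a) - L.der Y (L.der X a) := by
  rw [der_comm, br, der_sub_left]

theorem br_br (X Y Z : 𝔛) : L.br X (L.br Y Z) = L.br (L.br X Y) Z + L.br Y (L.br X Z) :=
  L.jacobi X Y Z

/-- The commutator of a derivation of the module of vector fields with an endomorphism. -/
def commEnd (X : 𝔛) (D : 𝔛 →+ 𝔛) (hD : ∀ (a : A) Z, D (a • Z) = a • D Z + L.der X a • Z)
    (T : 𝔛 →ₗ[A] 𝔛) : 𝔛 →ₗ[A] 𝔛 where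
  toFun Z := D (T Z) - T (D Z)
  map_add' Z Z' := by simp only [map_add]; abel
  map_smul' a Z := by simp only [map_smul, hD, map_add, RingHom.id_apply]; module

/-- The covariant derivative `∇_X T` of an endomorphism. -/
def nablaEnd (X : 𝔛) (T : 𝔛 →ₗ[A] 𝔛) : 𝔛 →ₗ[A] 𝔛 :=
  L.commEnd X (L.nabla X) (L.nabla_smul X) T

theorem nablaEnd_apply (X : 𝔛) (T : 𝔛 →ₗ[A] 𝔛) (Z : 𝔛) :
    L.nablaEnd X T Z = L.nabla X (T Z) - T (L.nabla X Z) := rfl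

theorem der_tr_nabla (X : 𝔛) (T : 𝔛 →ₗ[A] 𝔛) : L.der X (L.tr T) = L.tr (L.nablaEnd X T) :=
  L.tr_der X (L.nabla X) (L.nabla_smul X) T _ fun _ ↦ rfl

/-- The Lie derivative along `X`, as an additive map. -/
def lie (X : 𝔛) : 𝔛 →+ 𝔛 := AddMonoidHom.mk' (L.br X) (L.br_add_right X)

/-- The Lie derivative of an endomorphism. -/
def lieEnd (X : 𝔛) (T : 𝔛 →ₗ[A] 𝔛) : 𝔛 →ₗ[A] 𝔛 :=
  L.commEnd X (L.lie X) (L.br_smul_right X) T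

theorem lieEnd_apply (X : 𝔛) (T : 𝔛 →ₗ[A] 𝔛) (Z : 𝔛) :
    L.lieEnd X T Z = L.br X (T Z) - T (L.br X Z) := rfl

theorem der_tr_lie (X : 𝔛) (T : 𝔛 →ₗ[A] 𝔛) : L.der X (L.tr T) = L.tr (L.lieEnd X T) :=
  L.tr_der X (L.lie X) (L.br_smul_right X) T _ fun _ ↦ rfl

/-- The covariant derivative `X ↦ ∇_X Y` of a vector field. -/
def nablaHom (Y : 𝔛) : 𝔛 →ₗ[A] 𝔛 where
  toFun X := L.nabla X Y
  map_add' X X' := L.nabla_add_left X X' Y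
  map_smul' a X := L.nabla_smul_left a X Y

theorem nablaHom_apply (X Y : 𝔛) : L.nablaHom Y X = L.nabla X Y := rfl

/-- The differential of a function. -/
def dif (a : A) : 𝔛 →ₗ[A] A where
  toFun X := L.der X a
  map_add' X X' := L.der_add_left X X' a
  map_smul' c X := L.der_smul_left c X a

theorem dif_apply (X : 𝔛) (a : A) : L.dif a X = L.der X a := rfl

/-- The curvature `R(X, Y)Z = ∇_X ∇_Y Z - ∇_Y ∇_X Z - ∇_[X, Y] Z`. -/
def R : 𝔛 →ₗ[A] 𝔛 →ₗ[A] 𝔛 →ₗ[A] 𝔛 :=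
  LinearMap.mk₂ A
    (fun X Y ↦
      { toFun := fun Z ↦ L.nabla X (L.nabla Y Z) - L.nabla Y (L.nabla X Z) - L.nabla (L.br X Y) Z
        map_add' := fun Z Z' ↦ by simp only [map_add]; abel
        map_smul' := fun a Z ↦ by
          simp only [nabla_smul, map_add, der_br, RingHom.id_apply]; module })
    (fun X X' Y ↦ by
      ext Z
      simp only [br, map_add, map_sub, AddMonoidHom.add_apply, AddMonoidHom.sub_apply, LinearMap.coe_mk, AddHom.coe_mk,
        LinearMap.add_apply]
      abel)
    (fun a X Y ↦ by
      ext Z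
      simp only [br, map_smul, map_sub, map_add, AddMonoidHom.add_apply, AddMonoidHom.sub_apply,
        AddMonoidHom.smul_apply, nabla_smul,
        LinearMap.coe_mk, AddHom.coe_mk, LinearMap.smul_apply]
      module)
    (fun X Y Y' ↦ by
      ext Z
      simp only [br, map_add, map_sub, AddMonoidHom.add_apply, AddMonoidHom.sub_apply, LinearMap.coe_mk, AddHom.coe_mk,
        LinearMap.add_apply]
      abel)
    (fun a X Y ↦ by
      ext Z
      simp only [br, map_smul, map_sub, map_add, AddMonoidHom.add_apply, AddMonoidHom.sub_apply,
        AddMonoidHom.smul_apply, nabla_smul,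
        LinearMap.coe_mk, AddHom.coe_mk, LinearMap.smul_apply]
      module)

theorem R_apply (X Y Z : 𝔛) : L.R X Y Z =
    L.nabla X (L.nabla Y Z) - L.nabla Y (L.nabla X Z) - L.nabla (L.br X Y) Z := rfl

/-- The first Bianchi identity, arranged so that the endomorphism R(X,Y) becomes a difference of two
endomorphisms whose traces are Ricci contractions. -/
theorem R_cyclic (X Y Z : 𝔛) : L.R X Y Z = L.R Z Y X - L.R Z X Y := by
  have h := L.jacobi X Y Z
  simp only [R_apply, br, map_sub, AddMonoidHom.sub_apply] at h ⊢
  linear_combination (norm := module) h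

theorem g_R (X Y Z W : 𝔛) : L.g (L.R X Y Z) W = -L.g Z (L.R X Y W) := by
  have h := L.der_br X Y (L.g Z W)
  simp only [R_apply, map_sub, LinearMap.sub_apply, der_g, map_add] at h ⊢
  linear_combination -h

/-- The second Bianchi identity. -/
theorem R_bianchi (X Y Z W : 𝔛) :
    (L.nabla X (L.R Y Z W) - L.R Y Z (L.nabla X W) - L.R (L.br X Y) Z W) +
    (L.nabla Y (L.R Z X W) - L.R Z X (L.nabla Y W) - L.R (L.br Y Z) X W) +
    (L.nabla Z (L.R X Y W) - L.R X Y (L.nabla Z W) - L.R (L.br Z X) Y W) = 0 := by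
  have h : L.br (L.br X Y) Z + L.br (L.br Y Z) X + L.br (L.br Z X) Y = 0 := by
    have h := L.br_br X Y Z
    simp only [br, map_sub, AddMonoidHom.sub_apply] at h ⊢
    linear_combination (norm := module) -h
  have h' := congrArg (fun U ↦ L.nabla U W) h
  simp only [nabla_add_left, map_zero, AddMonoidHom.zero_apply] at h'
  simp only [R_apply, map_sub]
  linear_combination (norm := module) h'

/-- The Lie derivative of the metric. -/
def lieG (V X Y : 𝔛) : A := L.g (L.nabla X V) Y + L.g X (L.nabla Y V)

theorem der_g_lie (V X Y : 𝔛) :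
    L.der V (L.g X Y) = L.lieG V X Y + L.g (L.br V X) Y + L.g X (L.br V Y) := by
  simp only [lieG, br, der_g, map_sub, LinearMap.sub_apply]; ring

/-- The Lie derivative of the connection. -/
def lieNabla (V X Y : 𝔛) : 𝔛 :=
  L.br V (L.nabla X Y) - L.nabla (L.br V X) Y - L.nabla X (L.br V Y)

/-- The antisymmetric part is £_V of the torsion, and the torsion is zero. -/
theorem lieNabla_symm (V X Y : 𝔛) : L.lieNabla V X Y = L.lieNabla V Y X := by
  have h := L.br_br V X Y
  simp only [lieNabla, br, map_sub, AddMonoidHom.sub_apply] at h ⊢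
  linear_combination (norm := module) h

/-- Apply [V, X] to g(Y,Z): since ∇g = 0, the failure of £_V and ∇_X to commute on g is carried by
£_V∇ alone. -/
theorem der_lieG (V X Y Z : 𝔛) :
    L.der X (L.lieG V Y Z) - L.lieG V (L.nabla X Y) Z - L.lieG V Y (L.nabla X Z) =
      L.g (L.lieNabla V X Y) Z + L.g Y (L.lieNabla V X Z) := by
  have h (U W : 𝔛) : L.lieG V U W =
      L.der V (L.g U W) - L.g (L.br V U) W - L.g U (L.br V W) := by rw [der_g_lie]; ring
  have h1 := L.der_br V X (L.g Y Z)
  simp only [h, lieNabla, map_sub, map_add, LinearMap.sub_apply, der_g] at h1 ⊢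
  linear_combination h1

/-- The Koszul trick: £_V∇ is symmetric, so the alternating cyclic sum of `der_lieG` isolates it. -/
theorem two_g_lieNabla (V X Y Z : 𝔛) : 2 * L.g (L.lieNabla V X Y) Z =
    (L.der X (L.lieG V Y Z) - L.lieG V (L.nabla X Y) Z - L.lieG V Y (L.nabla X Z)) +
    (L.der Y (L.lieG V X Z) - L.lieG V (L.nabla Y X) Z - L.lieG V X (L.nabla Y Z)) -
    (L.der Z (L.lieG V X Y) - L.lieG V (L.nabla Z X) Y - L.lieG V X (L.nabla Z Y)) := by
  rw [der_lieG, der_lieG, der_lieG, L.lieNabla_symm V Y X, L.lieNabla_symm V Z X,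
    L.lieNabla_symm V Z Y, L.g_symm Y, L.g_symm X]
  ring

/-- £_V fails to commute with the covariant derivatives in R only through £_V∇; the leftover
derivatives along brackets cancel by the Jacobi identity. -/
theorem lie_R (V X Y Z : 𝔛) :
    L.br V (L.R X Y Z) - L.R (L.br V X) Y Z - L.R X (L.br V Y) Z - L.R X Y (L.br V Z) =
    (L.nabla X (L.lieNabla V Y Z) - L.lieNabla V (L.nabla X Y) Z - L.lieNabla V Y (L.nabla X Z)) -
    (L.nabla Y (L.lieNabla V X Z) - L.lieNabla V (L.nabla Y X) Z -
      L.lieNabla V X (L.nabla Y Z)) := by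
  have h : L.nabla (L.br V (L.nabla X Y)) Z - L.nabla (L.br V (L.nabla Y X)) Z =
      L.nabla (L.br (L.br V X) Y) Z + L.nabla (L.br X (L.br V Y)) Z := by
    rw [← nabla_sub_left, ← br_sub_right, ← nabla_add_left, ← br_br]; rfl
  have h2 : L.nabla (L.br X Y) Z = L.nabla (L.nabla X Y) Z - L.nabla (L.nabla Y X) Z :=
    L.nabla_sub_left _ _ _
  have h3 : L.nabla (L.br X Y) (L.br V Z) =
      L.nabla (L.nabla X Y) (L.br V Z) - L.nabla (L.nabla Y X) (L.br V Z) :=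
    L.nabla_sub_left _ _ _
  simp only [R_apply, lieNabla, br_sub_right, map_sub, h2, h3]
  linear_combination (norm := module) -h

end RiemannianCalculus

/-! ### Weak Kenmotsu structures and the shifted curvature. -/

namespace RiemannianCalculus

/-- A weak `β`-Kenmotsu structure, in algebraic form. -/
structure Kenmotsu {A 𝔛 : Type*} [CommRing A] [AddCommGroup 𝔛] [Module A 𝔛]
    (L : RiemannianCalculus A 𝔛) (β : A) where
  f : 𝔛 →ₗ[A] 𝔛
  ξ : 𝔛
  der_β : ∀ X, L.der X β = 0
  f_ξ : f ξ = 0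
  g_ξ_ξ : L.g ξ ξ = 1
  g_f : ∀ X Y, L.g (f X) Y = -L.g X (f Y)
  nabla_f : ∀ X Y, L.nabla X (f Y) =
    f (L.nabla X Y) + β • (L.g (f X) Y • ξ - L.g ξ Y • f X)
  -- This comes from the injectivity of Q; Q itself is not needed in the abstract argument.
  ker_f : ∀ X, f X = 0 → X = L.g ξ X • ξ

namespace Kenmotsu

variable {A 𝔛 : Type*} [CommRing A] [AddCommGroup 𝔛] [Module A 𝔛]
  {L : RiemannianCalculus A 𝔛} {β : A} (K : L.Kenmotsu β)

theorem g_f_symm (X Y : 𝔛) : L.g X (K.f Y) = -L.g (K.f X) Y := by rw [g_f, neg_neg]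

theorem g_f_swap (X Y : 𝔛) : L.g (K.f X) Y = -L.g (K.f Y) X := by rw [g_f, L.g_symm]

theorem g_ξ_f (X : 𝔛) : L.g K.ξ (K.f X) = 0 := by rw [g_f_symm, f_ξ, map_zero]; simp

theorem g_f_ξ (X : 𝔛) : L.g (K.f X) K.ξ = 0 := by rw [L.g_symm, g_ξ_f]

theorem g_ξ_nabla_ξ (X : 𝔛) : L.g K.ξ (L.nabla X K.ξ) = 0 := by
  have h := L.der_g X K.ξ K.ξ
  rw [g_ξ_ξ, Derivation.map_one_eq_zero, L.g_symm (L.nabla X K.ξ)] at h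
  exact L.natCast_cancel 2 _ two_ne_zero (by rw [Nat.cast_ofNat, h]; ring)

/-- The Kenmotsu identity at Y = ξ says f(∇_X ξ − βX) = 0, so the difference is a multiple of ξ; |ξ|
= 1 determines which. -/
theorem nabla_ξ (X : 𝔛) : L.nabla X K.ξ = β • (X - L.g K.ξ X • K.ξ) := by
  have h := K.nabla_f X K.ξ
  rw [f_ξ, map_zero, g_f_ξ, g_ξ_ξ] at h
  have h2 : K.f (L.nabla X K.ξ - β • X) = 0 := by
    rw [map_sub, map_smul]
    linear_combination (norm := module) -h
  have h3 := K.ker_f _ h2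
  rw [map_sub, g_ξ_nabla_ξ, map_smul, smul_eq_mul] at h3
  linear_combination (norm := module) h3

theorem der_η (X Y : 𝔛) : L.der X (L.g K.ξ Y) =
    β * (L.g X Y - L.g K.ξ X * L.g K.ξ Y) + L.g K.ξ (L.nabla X Y) := by
  rw [der_g, nabla_ξ]
  simp only [map_sub, map_smul, LinearMap.sub_apply, LinearMap.smul_apply, smul_eq_mul]

/-- The metric contraction `(X, Y, Z) ↦ g(Y, Z) X - g(X, Z) Y`. -/
def wedge (L : RiemannianCalculus A 𝔛) : 𝔛 →ₗ[A] 𝔛 →ₗ[A] 𝔛 →ₗ[A] 𝔛 :=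
  LinearMap.mk₂ A
    (fun X Y ↦ (L.g Y).smulRight X - (L.g X).smulRight Y)
    (fun X X' Y ↦ by ext Z; simp; module)
    (fun a X Y ↦ by ext Z; simp; module)
    (fun X Y Y' ↦ by ext Z; simp; module)
    (fun a X Y ↦ by ext Z; simp; module)

/-- The curvature shifted by that of hyperbolic space. -/
def Rh (L : RiemannianCalculus A 𝔛) (β : A) : 𝔛 →ₗ[A] 𝔛 →ₗ[A] 𝔛 →ₗ[A] 𝔛 := L.R + β ^ 2 • wedge L

theorem Rh_apply (X Y Z : 𝔛) :
    Rh L β X Y Z = L.R X Y Z + β ^ 2 • (L.g Y Z • X - L.g X Z • Y) := rfl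

theorem Rh_cyclic (X Y Z : 𝔛) : Rh L β X Y Z = Rh L β Z Y X - Rh L β Z X Y := by
  rw [Rh_apply, Rh_apply, Rh_apply, L.R_cyclic, L.g_symm Y Z, L.g_symm X Z, L.g_symm X Y]
  module

theorem g_Rh (X Y Z W : 𝔛) : L.g (Rh L β X Y Z) W = -L.g Z (Rh L β X Y W) := by
  simp only [Rh_apply, map_add, map_sub, map_smul, LinearMap.add_apply, LinearMap.sub_apply,
    LinearMap.smul_apply, g_R, smul_eq_mul, L.g_symm Z X, L.g_symm Z Y]
  ring

/-- Differentiating ∇ξ = β(id − η⊗ξ) gives R(X,Y)ξ = −β²(η(Y)X − η(X)Y), which the shift cancels. -/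
theorem Rh_ξ (X Y : 𝔛) : Rh L β X Y K.ξ = 0 := by
  simp only [Rh_apply, R_apply, nabla_ξ, br, nabla_smul, map_sub, K.der_β, der_η,
    AddMonoidHom.sub_apply, L.g_symm X K.ξ, L.g_symm Y K.ξ, L.g_symm Y X]
  module

/-- Antisymmetrised second derivatives of f give the commutator [R(X,Y), f]; it is opposite to the
commutator of f with the shift. -/
theorem Rh_f (X Y Z : 𝔛) : Rh L β X Y (K.f Z) = K.f (Rh L β X Y Z) := by
  simp only [Rh_apply, R_apply, nabla_f, nabla_ξ, br, nabla_smul, map_sub, map_add, map_smul,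
    K.der_β, der_g,
    AddMonoidHom.sub_apply, LinearMap.sub_apply, LinearMap.add_apply, LinearMap.smul_apply,
    g_f_symm, smul_eq_mul]
  module

/-- The shift is built from g and the constant β, so it is parallel and preserves the second Bianchi
identity. -/
theorem Rh_bianchi (K : L.Kenmotsu β) (X Y Z W : 𝔛) :
    (L.nabla X (Rh L β Y Z W) - Rh L β Y Z (L.nabla X W) - Rh L β (L.br X Y) Z W) +
    (L.nabla Y (Rh L β Z X W) - Rh L β Z X (L.nabla Y W) - Rh L β (L.br Y Z) X W) +
    (L.nabla Z (Rh L β X Y W) - Rh L β X Y (L.nabla Z W) - Rh L β (L.br Z X) Y W) = 0 := by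
  have h := L.R_bianchi X Y Z W
  have hβ (U : 𝔛) : L.der U (β ^ 2) = 0 := by simp [pow_two, K.der_β]
  simp only [Rh_apply, br, map_add, map_sub, nabla_smul, hβ, der_g, LinearMap.sub_apply] at h ⊢
  linear_combination (norm := module) h

end Kenmotsu

end RiemannianCalculus

/-! ### Traces under the η-Einstein condition. -/

namespace RiemannianCalculus.Kenmotsu

variable {A 𝔛 : Type*} [CommRing A] [AddCommGroup 𝔛] [Module A 𝔛]
  {L : RiemannianCalculus A 𝔛} {β : A} (K : L.Kenmotsu β)

theorem tr_Rh (n : A) (hn : L.tr LinearMap.id = 2 * n + 1) (Y Z : 𝔛) :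
    L.tr (((Rh L β).flip Y).flip Z) =
      L.tr ((L.R.flip Y).flip Z) + 2 * n * β ^ 2 * L.g Y Z := by
  have h : ((Rh L β).flip Y).flip Z = (L.R.flip Y).flip Z +
      β ^ 2 • (L.g Y Z • LinearMap.id - (L.g Z).smulRight Y) := by
    ext X
    simp [Rh_apply, L.g_symm X Z]
  rw [h, map_add, map_smul, map_sub, map_smul, hn, tr_smulRight, L.g_symm Z Y]
  simp only [smul_eq_mul]
  ring

theorem tr_Rh_ξ (Y : 𝔛) : L.tr (((Rh L β).flip Y).flip K.ξ) = 0 := by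
  have h : ((Rh L β).flip Y).flip K.ξ = 0 := by
    ext X
    simp [K.Rh_ξ]
  rw [h, map_zero]

/-- In an `η`-Einstein structure `Ric = a g + b η ⊗ η`, we have `a + b = -2nβ²`. -/
theorem add_eq_of_etaEinstein {a b n : A} (hn : L.tr LinearMap.id = 2 * n + 1)
    (hR : ∀ Y Z, L.tr ((L.R.flip Y).flip Z) = a * L.g Y Z + b * (L.g K.ξ Y * L.g K.ξ Z)) :
    a + b = -2 * n * β ^ 2 := by
  have h := K.tr_Rh_ξ K.ξ
  rw [tr_Rh n hn, hR, g_ξ_ξ] at h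
  linear_combination h

theorem tr_Rh_of_etaEinstein {a b n : A} (hn : L.tr LinearMap.id = 2 * n + 1)
    (hR : ∀ Y Z, L.tr ((L.R.flip Y).flip Z) = a * L.g Y Z + b * (L.g K.ξ Y * L.g K.ξ Z))
    (Y Z : 𝔛) : L.tr (((Rh L β).flip Y).flip Z) = -b * (L.g Y Z - L.g K.ξ Y * L.g K.ξ Z) := by
  rw [tr_Rh n hn, hR]
  linear_combination L.g Y Z * K.add_eq_of_etaEinstein hn hR

/-- The shifted Ricci tensor is `-b (g - η ⊗ η)`. -/
def EtaEinstein (b : A) : Prop :=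
  ∀ Y Z, L.tr (((Rh L β).flip Y).flip Z) = -b * (L.g Y Z - L.g K.ξ Y * L.g K.ξ Z)

variable {b : A} (hb : K.EtaEinstein b)

/-- By first Bianchi and commutation with f, f Rh(X,Y)Z = Rh(Z,Y)fX − Rh(Z,X)fY; both traces over Z
are shifted Ricci contractions. -/
theorem tr_f_Rh (hb : K.EtaEinstein b) (X Y : 𝔛) :
    L.tr (K.f ∘ₗ Rh L β X Y) = -2 * b * L.g (K.f X) Y := by
  have h : K.f ∘ₗ Rh L β X Y =
      ((Rh L β).flip Y).flip (K.f X) - ((Rh L β).flip X).flip (K.f Y) := by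
    ext Z
    simp only [LinearMap.comp_apply, LinearMap.sub_apply, LinearMap.flip_apply]
    rw [Rh_cyclic, map_sub, Rh_f, Rh_f]
  rw [h, map_sub, hb, hb, g_ξ_f, g_ξ_f, L.g_symm Y, g_f_symm]
  ring

/-- The `∗`-Ricci tensor of an `η`-Einstein structure. -/
theorem tr_f_R (hb : K.EtaEinstein b) (X Y : 𝔛) :
    L.tr (K.f ∘ₗ L.R X (K.f Y)) = -2 * (b + β ^ 2) * L.g (K.f X) (K.f Y) := by
  have h : K.f ∘ₗ L.R X (K.f Y) = K.f ∘ₗ Rh L β X (K.f Y) -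
      β ^ 2 • ((L.g (K.f Y)).smulRight (K.f X) - (L.g X).smulRight (K.f (K.f Y))) := by
    ext Z
    simp only [LinearMap.comp_apply, LinearMap.sub_apply, Rh_apply, map_add, map_sub, map_smul,
      LinearMap.smul_apply, LinearMap.smulRight_apply]
    abel
  rw [h, map_sub, K.tr_f_Rh hb, map_smul, map_sub, tr_smulRight, tr_smulRight, smul_eq_mul,
    K.g_f_symm X, L.g_symm (K.f Y)]
  ring

/-- The one-form `θ = db + 2βb η`. -/
def θ (b : A) : 𝔛 →ₗ[A] A := L.dif b + (2 * β * b) • L.g K.ξ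

theorem θ_apply (X : 𝔛) : K.θ b X = L.der X b + 2 * β * b * L.g K.ξ X := rfl

theorem der_eq (X : 𝔛) : L.der X b = K.θ b X - 2 * β * b * L.g K.ξ X := by
  rw [θ_apply]; ring

/-- Compose the second Bianchi identity with f and take traces: the 2-form bΦ is closed. Since dΦ =
2βη∧Φ, this is θ∧Φ = 0. -/
theorem θ_wedge (hb : K.EtaEinstein b) (X Y Z : 𝔛) :
    K.θ b X * L.g (K.f Y) Z + K.θ b Y * L.g (K.f Z) X + K.θ b Z * L.g (K.f X) Y = 0 := by
  have hη (Y Z W : 𝔛) : L.g K.ξ (Rh L β Y Z W) = 0 := by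
    rw [L.g_symm, g_Rh, Rh_ξ, map_zero, neg_zero]
  have h : L.nablaEnd X (K.f ∘ₗ Rh L β Y Z) + L.nablaEnd Y (K.f ∘ₗ Rh L β Z X) +
      L.nablaEnd Z (K.f ∘ₗ Rh L β X Y) =
      K.f ∘ₗ Rh L β (L.br X Y) Z + K.f ∘ₗ Rh L β (L.br Y Z) X + K.f ∘ₗ Rh L β (L.br Z X) Y +
      β • ((L.g (K.f X) ∘ₗ Rh L β Y Z).smulRight K.ξ + (L.g (K.f Y) ∘ₗ Rh L β Z X).smulRight K.ξ +
        (L.g (K.f Z) ∘ₗ Rh L β X Y).smulRight K.ξ) := by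
    ext W
    have h1 := congrArg K.f (K.Rh_bianchi X Y Z W)
    simp only [map_add, map_sub, map_zero] at h1
    simp only [LinearMap.add_apply, nablaEnd_apply, LinearMap.comp_apply, nabla_f, hη,
      LinearMap.smul_apply, LinearMap.smulRight_apply]
    linear_combination (norm := module) h1
  have h2 := congrArg L.tr h
  -- The ξ-valued terms produced by ∇f have traces of the form g(fX, Rh(Y,Z)ξ) = 0.
  simp only [map_add, map_smul, tr_smulRight, LinearMap.comp_apply, Rh_ξ, map_zero,
    ← der_tr_nabla, K.tr_f_Rh hb] at h2
  refine L.natCast_cancel 2 _ two_ne_zero ?_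
  have hc : ∀ U, L.der U (-2 * b) = -2 * L.der U b := fun U ↦ by
    rw [show (-2 : A) * b = (-2 : ℤ) • b by simp, map_zsmul]; simp
  simp only [der_mul, hc, der_g, nabla_f, map_add, map_sub, map_smul, LinearMap.add_apply,
    LinearMap.sub_apply, LinearMap.smul_apply, smul_eq_mul, br] at h2
  rw [K.g_f_swap Y (L.nabla X Z), K.g_f_swap Z (L.nabla Y X), K.g_f_swap X (L.nabla Z Y),
    K.g_f_swap Y X, K.g_f_swap Z Y, K.g_f_swap X Z] at h2
  simp only [θ_apply]
  push_cast
  linear_combination -h2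

end RiemannianCalculus.Kenmotsu

/-! ### The soliton equation and the Hessian of η(V). -/

namespace RiemannianCalculus.Kenmotsu

variable {A 𝔛 : Type*} [CommRing A] [AddCommGroup 𝔛] [Module A 𝔛]
  {L : RiemannianCalculus A 𝔛} {β : A} (K : L.Kenmotsu β)

/-- The soliton equation `£_V g = 2 (l g + m η ⊗ η - Ric*)`, with `Ric* = -(b + β²) g(f ·, f ·)`. -/
structure Soliton (b : A) (V : 𝔛) (l m : A) : Prop where
  der_l : ∀ X, L.der X l = 0
  der_m : ∀ X, L.der X m = 0
  lieG_eq : ∀ X Y, L.lieG V X Y = 2 * l * L.g X Y + 2 * m * (L.g K.ξ X * L.g K.ξ Y) +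
    2 * (b + β ^ 2) * L.g (K.f X) (K.f Y)

variable {K} {b : A} {V : 𝔛} {l m : A}

/-- The gradient of `η(V)`. -/
def gradη (K : L.Kenmotsu β) (V : 𝔛) : 𝔛 := L.grad (L.g K.ξ V)

theorem g_gradη (K : L.Kenmotsu β) (V X : 𝔛) : L.g (K.gradη V) X = L.der X (L.g K.ξ V) :=
  L.g_grad _ _

/-- This is the soliton equation on (ξ, Z), where the Ric* term drops out because fξ = 0. -/
theorem Soliton.br_ξ (S : K.Soliton b V l m) :
    L.br V K.ξ = K.gradη V - (2 * (l + m)) • K.ξ := by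
  refine L.g_ext _ _ fun Z ↦ ?_
  have h := S.lieG_eq K.ξ Z
  rw [f_ξ, map_zero, lieG] at h
  simp only [br, map_sub, map_smul, LinearMap.sub_apply, LinearMap.smul_apply, smul_eq_mul,
    g_gradη, der_η, nabla_ξ, g_ξ_ξ, LinearMap.zero_apply, L.g_symm V Z] at h ⊢
  linear_combination -h

theorem Soliton.g_gradη_ξ (S : K.Soliton b V l m) : L.g (K.gradη V) K.ξ = l + m := by
  have h := S.lieG_eq K.ξ K.ξ
  rw [f_ξ, map_zero, lieG, L.g_symm _ K.ξ, g_ξ_ξ] at h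
  rw [g_gradη, der_η, g_ξ_ξ]
  refine L.two_cancel_eq ?_
  linear_combination h

/-- In the Koszul-type formula for (X, ξ, Z) the terms (∇_X £_V g)(ξ,Z) and (∇_Z £_V g)(X,ξ) agree
and cancel. In ∇_ξ £_V g only ξ(b) survives, as g, η and f are parallel along ξ. -/
theorem Soliton.lieNabla_ξ (S : K.Soliton b V l m) (X : 𝔛) :
    L.lieNabla V X K.ξ = -L.der K.ξ b • K.f (K.f X) := by
  refine L.g_ext _ _ fun Z ↦ L.two_cancel_eq ?_
  have hβ (U : 𝔛) : L.der U (β ^ 2) = 0 := by simp [pow_two, K.der_β]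
  have h2 (U : 𝔛) : L.der U 2 = 0 := by simpa using (L.der U).map_natCast 2
  rw [two_g_lieNabla]
  simp only [S.lieG_eq, map_add, der_mul, S.der_l, S.der_m, hβ, h2, f_ξ, map_zero,
    LinearMap.zero_apply, der_g, nabla_f, nabla_ξ, map_sub, map_smul, LinearMap.add_apply,
    LinearMap.sub_apply, LinearMap.smul_apply, smul_eq_mul, g_ξ_ξ, g_ξ_f, g_f_ξ,
    K.g_f (K.f X) Z, Derivation.map_one_eq_zero, L.g_symm X K.ξ, L.g_symm Z X,
    L.g_symm (L.nabla Z X) K.ξ]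
  ring

/-- The Hessian of `η(V)`. -/
theorem Soliton.nabla_gradη (S : K.Soliton b V l m) (hθ : K.θ b K.ξ = 0) (X : 𝔛) :
    L.nabla X (K.gradη V) = (2 * (l + m) * β) • X - (2 * β * b) • K.f (K.f X) -
      (β * L.g (K.gradη V) X) • K.ξ - (β * L.g K.ξ X) • K.gradη V := by
  have h := S.lieNabla_ξ X
  have hξ : L.der K.ξ b = -2 * β * b := by
    rw [der_eq K, hθ, g_ξ_ξ]; ring
  have hη : L.der V (L.g K.ξ X) = L.g (K.gradη V) X + L.g K.ξ (L.br V X) := by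
    rw [der_g_lie, S.br_ξ, S.lieG_eq, f_ξ, map_zero, g_ξ_ξ]
    simp only [map_sub, map_smul, LinearMap.sub_apply, LinearMap.smul_apply, smul_eq_mul,
      LinearMap.zero_apply]
    ring
  have h2 (U : 𝔛) : L.der U 2 = 0 := by simpa using (L.der U).map_natCast 2
  -- Unfolded, (£_V∇)(X,ξ) contains ∇_X[V,ξ] = ∇_X G − 2(l+m)∇_X ξ, and every other term is known;
  -- solve for ∇_X G.
  rw [lieNabla, S.br_ξ, hξ] at h
  simp only [nabla_ξ, br_smul_right, br_sub_right, hη, K.der_β, map_sub, map_add, nabla_smul,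
    der_mul, S.der_l, S.der_m, S.br_ξ, h2] at h
  linear_combination (norm := module) -h

/-- The Ricci identity: antisymmetrise the derivative of the Hessian formula. The derivatives of b
combine with the η-terms into θ. -/
theorem Soliton.Rh_gradη (S : K.Soliton b V l m) (hθ : K.θ b K.ξ = 0) (X Y : 𝔛) :
    Rh L β X Y (K.gradη V) =
      (2 * β) • (K.θ b Y • K.f (K.f X) - K.θ b X • K.f (K.f Y)) -
        (2 * (l + m) * β ^ 2) • (L.g K.ξ Y • X - L.g K.ξ X • Y) := by
  have h2 (U : 𝔛) : L.der U 2 = 0 := by simpa using (L.der U).map_natCast 2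
  have hb (U : 𝔛) : L.der U b = K.θ b U - 2 * β * b * L.g K.ξ U := K.der_eq U
  have hηG : L.g K.ξ (K.gradη V) = l + m := by rw [L.g_symm, S.g_gradη_ξ]
  simp only [Rh_apply, R_apply, S.nabla_gradη hθ, map_sub, map_add, nabla_smul, der_mul, S.der_l,
    S.der_m, h2, K.der_β, hb, nabla_f, nabla_ξ, der_g, br, map_smul, AddMonoidHom.sub_apply,
    LinearMap.sub_apply, LinearMap.smul_apply, smul_eq_mul, f_ξ, g_ξ_f,
    K.g_f_swap Y X, L.g_symm Y X, 
    L.g_symm Y (K.gradη V), L.g_symm X (K.gradη V), K.g_f (K.f X) Y, K.g_f (K.f Y) X,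
    L.g_symm (K.f Y) (K.f X)]
  module

/-- The trace over X of `Soliton.Rh_gradη`. At Y = ξ it forces l + m = 0; after that it ties bG to
θ. -/
theorem Soliton.tr_Rh_gradη (S : K.Soliton b V l m) (hb : K.EtaEinstein b) (hθ : K.θ b K.ξ = 0)
    {n : A} (hn : L.tr LinearMap.id = 2 * n + 1) (Y : 𝔛) :
    -b * (L.g (K.gradη V) Y - L.g K.ξ Y * (l + m)) =
      2 * β * (K.θ b Y * L.tr (K.f ∘ₗ K.f) - K.θ b (K.f (K.f Y))) -
        4 * n * (l + m) * β ^ 2 * L.g K.ξ Y := by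
  have h : ((Rh L β).flip Y).flip (K.gradη V) =
      (2 * β) • (K.θ b Y • (K.f ∘ₗ K.f) - (K.θ b).smulRight (K.f (K.f Y))) -
        (2 * (l + m) * β ^ 2) • (L.g K.ξ Y • LinearMap.id - (L.g K.ξ).smulRight Y) := by
    ext X
    simp only [LinearMap.flip_apply, S.Rh_gradη hθ, LinearMap.sub_apply, LinearMap.smul_apply,
      LinearMap.smulRight_apply, LinearMap.comp_apply, LinearMap.id_apply]
  have h2 := congrArg L.tr h
  rw [hb] at h2
  simp only [map_sub, map_smul, tr_smulRight, hn, smul_eq_mul] at h2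
  rw [L.g_symm, L.g_symm K.ξ (K.gradη V), S.g_gradη_ξ] at h2
  linear_combination h2

/-- The trace of `f²` is constant. -/
theorem der_tr_f_f (K : L.Kenmotsu β) (X : 𝔛) : L.der X (L.tr (K.f ∘ₗ K.f)) = 0 := by
  have h : L.nablaEnd X (K.f ∘ₗ K.f) =
      β • (-(L.g (K.f (K.f X))).smulRight K.ξ - (L.g K.ξ).smulRight (K.f (K.f X))) := by
    ext Y
    simp only [nablaEnd_apply, LinearMap.comp_apply, nabla_f, map_add, map_smul, map_sub,
      LinearMap.smul_apply, LinearMap.sub_apply, LinearMap.neg_apply, LinearMap.smulRight_apply,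
      f_ξ, g_f_symm, map_zero, LinearMap.zero_apply]
    module
  rw [der_tr_nabla, h, map_smul, map_sub, map_neg, tr_smulRight, tr_smulRight, g_f_ξ, g_ξ_f]
  simp

/-- If `b grad η(V) = 0` then `b` vanishes up to torsion. -/
theorem Soliton.pow_mul_eq_zero (S : K.Soliton b V l m) (hθ : K.θ b K.ξ = 0) (hs : l + m = 0)
    (h : b • K.gradη V = 0) (X : 𝔛) : 2 * β * b ^ 3 * L.g (K.f X) (K.f X) = 0 := by
  have h1 := congrArg (L.nabla X) h
  rw [map_zero, nabla_smul, S.nabla_gradη hθ, hs] at h1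
  -- The additional factor b lets bG = 0 kill all terms except the one with b f²X.
  have h2 := congrArg (fun Z ↦ b • L.g Z X) h1
  have h3 := congrArg (fun Z ↦ L.g Z X) h
  simp only [map_add, map_sub, map_smul, LinearMap.add_apply, LinearMap.sub_apply,
    LinearMap.smul_apply, smul_eq_mul, map_zero, LinearMap.zero_apply, K.g_f (K.f X)] at h2 h3
  linear_combination h2 - (L.der X b - 2 * b * β * L.g K.ξ X) * h3

end RiemannianCalculus.Kenmotsu

/-! ### Dimension three. -/

namespace RiemannianCalculus.Kenmotsu

variable {A 𝔛 : Type*} [CommRing A] [AddCommGroup 𝔛] [Module A 𝔛]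
  {L : RiemannianCalculus A 𝔛} {β : A} {K : L.Kenmotsu β}

/-- `f² = -c` on `ker η` for a constant `c`, as in dimension three. -/
structure Conformal (K : L.Kenmotsu β) (c : A) : Prop where
  der_c : ∀ X, L.der X c = 0
  f_f : ∀ X, K.f (K.f X) = -c • (X - L.g K.ξ X • K.ξ)

variable {b : A} {V : 𝔛} {l m c : A}

/-- Here g(f·,f·) = c(g − η⊗η) and m = −l, so all terms are proportional to the transverse metric.
-/
theorem Conformal.lieG_eq (C : K.Conformal c) (S : K.Soliton b V l m) (hs : l + m = 0) (X Y : 𝔛) :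
    L.lieG V X Y = 2 * (l + c * (b + β ^ 2)) * (L.g X Y - L.g K.ξ X * L.g K.ξ Y) := by
  rw [S.lieG_eq, g_f, C.f_f, map_smul, map_sub, map_smul]
  rw [eq_neg_of_add_eq_zero_right hs, L.g_symm X K.ξ]
  simp only [smul_eq_mul]
  ring

theorem Conformal.tr_f_f (C : K.Conformal c) (hn : L.tr LinearMap.id = 2 * 1 + 1) :
    L.tr (K.f ∘ₗ K.f) = -2 * c := by
  have h : K.f ∘ₗ K.f = -c • (LinearMap.id - (L.g K.ξ).smulRight K.ξ) := by
    ext X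
    exact C.f_f X
  rw [h, map_smul, map_sub, tr_smulRight, hn, g_ξ_ξ, smul_eq_mul]
  ring

theorem Conformal.mul_gradη (C : K.Conformal c) (S : K.Soliton b V l m) (hb : K.EtaEinstein b)
    (hθ : K.θ b K.ξ = 0) (hn : L.tr LinearMap.id = 2 * 1 + 1) (hs : l + m = 0) (Y : 𝔛) :
    b * L.g (K.gradη V) Y = 2 * β * c * K.θ b Y := by
  have h := S.tr_Rh_gradη hb hθ hn Y
  rw [hs, C.tr_f_f hn, C.f_f, map_smul, map_sub, map_smul, hθ] at h
  simp only [smul_eq_mul] at h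
  linear_combination -h

/-- The conformal factor of `V` is `l + c (b + β²)`. -/
theorem Conformal.lieNabla_eq (C : K.Conformal c) (S : K.Soliton b V l m) (hs : l + m = 0) {σ : A}
    (hσ : σ = l + c * (b + β ^ 2)) (X Y : 𝔛) :
    L.lieNabla V X Y = L.g (L.grad σ) X • (Y - L.g K.ξ Y • K.ξ) +
      L.g (L.grad σ) Y • (X - L.g K.ξ X • K.ξ) -
      (L.g X Y - L.g K.ξ X * L.g K.ξ Y) • (L.grad σ + (2 * β * σ) • K.ξ) := by
  -- The Koszul-type formula applied to £_V g = 2σ(g − η⊗η); the ξ-term comes from ∇η = β(g − η⊗η).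
  refine L.g_ext _ _ fun Z ↦ L.two_cancel_eq ?_
  have h2 (U : 𝔛) : L.der U 2 = 0 := by simpa using (L.der U).map_natCast 2
  rw [two_g_lieNabla]
  simp only [C.lieG_eq S hs, ← hσ, der_mul, h2, der_g, nabla_ξ, map_sub, map_add, map_smul,
    LinearMap.add_apply, LinearMap.sub_apply, LinearMap.smul_apply, smul_eq_mul, g_grad,
    L.g_symm Z X, L.g_symm Z Y, L.g_symm Y X,
    L.g_symm (L.nabla Z X) Y, L.g_symm (L.nabla Y X) Z, L.g_symm X (L.nabla Y Z),
    L.g_symm Y (L.nabla X Z), L.g_symm X (L.nabla Z Y)]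
  ring

theorem hessian_symm (L : RiemannianCalculus A 𝔛) (a : A) (X Y : 𝔛) :
    L.g (L.nabla X (L.grad a)) Y = L.g (L.nabla Y (L.grad a)) X := by
  have h := L.der_comm X Y a
  rw [← L.g_grad a X, ← L.g_grad a Y, der_g, der_g, ← g_grad, ← g_grad] at h
  linear_combination h

/-- The derivative of `b` along `V`, from the Lie derivative of the Ricci tensor. -/
theorem Conformal.lie_ricci (C : K.Conformal c) (S : K.Soliton b V l m) (hb : K.EtaEinstein b)
    (hn : L.tr LinearMap.id = 2 * 1 + 1) (hs : l + m = 0) {σ : A}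
    (hσ : σ = l + c * (b + β ^ 2)) (Y Z : 𝔛) (hY : L.g K.ξ Y = 0) (hZ : L.g K.ξ Z = 0) :
    (L.der V b + 2 * b * σ + 4 * β ^ 2 * σ -
      L.tr (L.nablaHom (L.grad σ + (2 * β * σ) • K.ξ))) * L.g Y Z = 0 := by
  have h2 (U : 𝔛) : L.der U 2 = 0 := by simpa using (L.der U).map_natCast 2
  have hβ : L.der V (β ^ 2) = 0 := by simp [pow_two, K.der_β]
  have hηY (U : 𝔛) : L.g K.ξ (L.nabla U Y) = -β * L.g U Y := by
    have h := K.der_η U Y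
    rw [hY, map_zero] at h
    linear_combination -h
  have hηZ (U : 𝔛) : L.g K.ξ (L.nabla U Z) = -β * L.g U Z := by
    have h := K.der_η U Z
    rw [hZ, map_zero] at h
    linear_combination -h
  set G := L.grad σ with hG
  have hH' : L.g (L.nabla Z G) Y = L.g (L.nabla Y G) Z := hessian_symm L σ Z Y
  -- £_V of the endomorphism X ↦ Rh(X,Y)Z. The β² line is £_V of the shift; the remaining block is
  -- £_V R from `lie_R`, with Y, Z orthogonal to ξ.
  have h : L.lieEnd V (((Rh L β).flip Y).flip Z) =
      ((Rh L β).flip (L.br V Y)).flip Z + ((Rh L β).flip Y).flip (L.br V Z) +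
      β ^ 2 • ((2 * σ * L.g Y Z) • LinearMap.id - (2 * σ) • (L.g Z).smulRight Y) +
      ((L.g Y ∘ₗ L.nablaHom G).smulRight Z + (L.g Z ∘ₗ L.nablaHom G).smulRight Y -
        L.g Y Z • L.nablaHom (G + (2 * β * σ) • K.ξ) - (β * L.g G Y) • (L.g Z).smulRight K.ξ -
        (β * L.g G Z) • (L.g Y).smulRight K.ξ - (L.g (L.nabla Y G)).smulRight Z +
        (β * L.g Y Z) • (L.g G).smulRight K.ξ -
        L.g (L.nabla Y G) Z • (LinearMap.id - (L.g K.ξ).smulRight K.ξ) +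
        (β * L.g G Z) • ((L.g Y).smulRight K.ξ + (L.g K.ξ).smulRight Y) -
        (β * L.g Y Z) • (L.g K.ξ).smulRight (G + (2 * β * σ) • K.ξ) +
        (L.g Z).smulRight (L.nabla Y (G + (2 * β * σ) • K.ξ))) := by
    ext X
    have h1 := L.lie_R V X Y Z
    have h3 := L.der_g_lie V Y Z
    have h4 := L.der_g_lie V X Z
    rw [C.lieG_eq S hs, ← hσ] at h3 h4
    simp only [C.lieNabla_eq S hs hσ, ← hG] at h1
    simp only [map_add, map_sub, map_smul, map_zero, nabla_smul, nabla_ξ, der_g, der_mul, hηY, hηZ,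
      hY, hZ, h2, K.der_β, LinearMap.sub_apply, LinearMap.smul_apply, smul_eq_mul] at h1
    simp only [lieEnd_apply, LinearMap.flip_apply, LinearMap.add_apply, LinearMap.sub_apply,
      LinearMap.smul_apply, LinearMap.smulRight_apply, LinearMap.id_apply, LinearMap.comp_apply,
      nablaHom_apply, Rh_apply, br_add_right, br_sub_right, br_smul_right, hβ, h3, h4, hZ,
      map_add, nabla_smul, nabla_ξ, der_mul, K.der_β, h2, hY,
      L.g_symm Z X, L.g_symm Y X, L.g_symm Y (L.nabla X G), L.g_symm Z (L.nabla X G)]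
    rw [L.g_symm Y X] at h1
    linear_combination (norm := module) h1
  -- The trace of the Lie derivative is V applied to the trace −b g(Y,Z), which brings in V(b).
  have h5 := congrArg L.tr h
  have h3 := L.der_g_lie V Y Z
  rw [C.lieG_eq S hs, ← hσ] at h3
  rw [← der_tr_lie, hb, ← neg_mul_eq_neg_mul, Derivation.map_neg, der_mul, map_sub, der_mul, h3, hY,
    hZ, map_zero] at h5
  simp only [map_add, map_sub, map_smul, tr_smulRight, hn, hb _ _, hY, hZ, smul_eq_mul,
    LinearMap.comp_apply, nablaHom_apply, nabla_smul, nabla_ξ, g_ξ_ξ, L.g_symm Y K.ξ, L.g_symm Z K.ξ, L.g_symm G K.ξ,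
    L.g_symm Z Y, L.g_symm Z (L.nabla Y G), L.g_symm Y (L.nabla Z G), hH'] at h5
  linear_combination -h5

/-- The derivative of `b` along `V`. -/
theorem Conformal.der_V_b (C : K.Conformal c) (S : K.Soliton b V l m) (hb : K.EtaEinstein b)
    (hθ : K.θ b K.ξ = 0) (hn : L.tr LinearMap.id = 2 * 1 + 1) (hs : l + m = 0)
    (hf : ∀ a : A, (∀ X, a * L.g (K.f X) (K.f X) = 0) → a = 0) :
    4 * β ^ 2 * c * L.der V b =
      b * (L.g (K.gradη V) (K.gradη V) - 8 * β ^ 2 * c * l - 24 * β ^ 4 * c ^ 2) := by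
  obtain ⟨σ, hσ⟩ : ∃ σ, σ = l + c * (b + β ^ 2) := ⟨_, rfl⟩
  have h2 (U : 𝔛) : L.der U 2 = 0 := by simpa using (L.der U).map_natCast 2
  have h4 (U : 𝔛) : L.der U 4 = 0 := by simpa using (L.der U).map_natCast 4
  have hβ (U : 𝔛) : L.der U (β ^ 2) = 0 := by simp [pow_two, K.der_β]
  -- Y = Z = fX is orthogonal to ξ, and `hf` cancels |fX|².
  have hV : L.der V b + 2 * b * σ + 4 * β ^ 2 * σ -
      L.tr (L.nablaHom (L.grad σ + (2 * β * σ) • K.ξ)) = 0 :=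
    hf _ fun X ↦ C.lie_ricci S hb hn hs hσ _ _ (K.g_ξ_f X) (K.g_ξ_f X)
  have hdσ (X : 𝔛) : L.der X σ = c * L.der X b := by
    rw [hσ, map_add, S.der_l, der_mul, map_add, hβ, C.der_c]; ring
  have hG (X : 𝔛) := C.mul_gradη S hb hθ hn hs X
  have hηG : L.g (K.gradη V) K.ξ = 0 := by rw [S.g_gradη_ξ, hs]
  -- From dσ = c db and 2βcθ = b g(G,·): the unknown divergence of grad σ is thereby reduced to the
  -- known Hessian of η(V).
  have hgrad : (2 * β) • L.grad σ = b • K.gradη V - (4 * β ^ 2 * c * b) • K.ξ := by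
    refine L.g_ext _ _ fun Z ↦ ?_
    simp only [map_sub, map_smul, LinearMap.sub_apply, LinearMap.smul_apply, smul_eq_mul, g_grad,
      hdσ, hG, θ_apply]
    ring
  have hT : (2 * β) • L.nablaHom (L.grad σ + (2 * β * σ) • K.ξ) =
      (L.dif b).smulRight (K.gradη V) + b • ((-(2 * β * b)) • (K.f ∘ₗ K.f) -
        β • (L.g (K.gradη V)).smulRight K.ξ - β • (L.g K.ξ).smulRight (K.gradη V)) +
      (4 * β ^ 2 * (σ - c * b) * β) • (LinearMap.id - (L.g K.ξ).smulRight K.ξ) := by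
    ext X
    have h := congrArg (L.nabla X) hgrad
    rw [map_sub, nabla_smul, nabla_smul, nabla_smul, S.nabla_gradη hθ, hs] at h
    simp only [der_mul, h2, h4, hβ, K.der_β, C.der_c, nabla_ξ] at h
    simp only [LinearMap.smul_apply, LinearMap.add_apply, LinearMap.sub_apply, nablaHom_apply,
      LinearMap.smulRight_apply, dif_apply, LinearMap.comp_apply, LinearMap.id_apply, map_add,
      nabla_smul, der_mul, h2, K.der_β, hdσ, nabla_ξ]
    linear_combination (norm := module) h
  have h := congrArg L.tr hT
  simp only [map_add, map_sub, map_smul, tr_smulRight, hn, C.tr_f_f hn, g_ξ_ξ, smul_eq_mul, hηG,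
    L.g_symm K.ξ (K.gradη V), dif_apply] at h
  have hG1 := hG (K.gradη V)
  have hG2 := hG K.ξ
  rw [θ_apply, L.g_symm K.ξ, hηG] at hG1
  linear_combination 4 * β ^ 2 * c * hV + 2 * β * c * h - hG1 - 8 * b * β ^ 2 * c * hσ

/-- With u = |G|², w = g(G,V) and φ = η(V), derivation along G obeys 2βcG(b) = bu, G(u) = 4βbcu and
G(φ) = u. Repeatedly applying G to one relation therefore gives polynomial relations, from which w
and then φ are eliminated. -/
theorem Conformal.mul_gradη_eq_zero [IsReduced A] (C : K.Conformal c) (S : K.Soliton b V l m)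
    (hb : K.EtaEinstein b) (hθ : K.θ b K.ξ = 0) (hn : L.tr LinearMap.id = 2 * 1 + 1)
    (hs : l + m = 0) (hβ : IsUnit β) (hf : ∀ a : A, (∀ X, a * L.g (K.f X) (K.f X) = 0) → a = 0)
    (hpos : ∀ X, L.g X X = 0 → X = 0) : b • K.gradη V = 0 := by
  have hk (k : ℕ) (U : 𝔛) : L.der U (k : A) = 0 := (L.der U).map_natCast k
  have h2 (U : 𝔛) : L.der U 2 = 0 := by simpa using hk 2 U
  have h3 (U : 𝔛) : L.der U 3 = 0 := by simpa using hk 3 U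
  have h8 (U : 𝔛) : L.der U 8 = 0 := by simpa using hk 8 U
  have h16 (U : 𝔛) : L.der U 16 = 0 := by simpa using hk 16 U
  have h24 (U : 𝔛) : L.der U 24 = 0 := by simpa using hk 24 U
  have h48 (U : 𝔛) : L.der U 48 = 0 := by simpa using hk 48 U
  have hV := C.der_V_b S hb hθ hn hs hf
  have hG (X : 𝔛) := C.mul_gradη S hb hθ hn hs X
  have hB := S.nabla_gradη hθ
  have hLG := C.lieG_eq S hs (K.gradη V) (K.gradη V)
  have hηG : L.g K.ξ (K.gradη V) = 0 := by rw [L.g_symm, S.g_gradη_ξ, hs]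
  have hu (X : 𝔛) : L.der X (L.g (K.gradη V) (K.gradη V)) =
      4 * β * b * c * L.g (K.gradη V) X -
        2 * β * L.g K.ξ X * L.g (K.gradη V) (K.gradη V) := by
    rw [der_g, L.g_symm (K.gradη V) (L.nabla X _), hB, C.f_f, hs]
    simp only [map_sub, map_smul, LinearMap.sub_apply, LinearMap.smul_apply, smul_eq_mul, hηG,
      L.g_symm X (K.gradη V)]
    ring
  have hφ (X : 𝔛) : L.der X (L.g K.ξ V) = L.g (K.gradη V) X := (K.g_gradη V X).symm
  -- Apply [V, G] to φ, whose gradient is G, and compare with £_V g on (G, G).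
  have hw : 2 * L.der (K.gradη V) (L.g (K.gradη V) V) =
      L.der V (L.g (K.gradη V) (K.gradη V)) + L.lieG V (K.gradη V) (K.gradη V) := by
    have e1 := L.der_br V (K.gradη V) (L.g K.ξ V)
    rw [hφ, hφ, hφ] at e1
    have e2 := L.der_g_lie V (K.gradη V) (K.gradη V)
    rw [L.g_symm (L.br V _)] at e2
    linear_combination 2 * e1 + e2
  rw [hLG, hηG] at hw
  set G := K.gradη V with hGdef
  set u := L.g G G with hudef
  set w := L.g G V with hwdef
  set φ := L.g K.ξ V with hφdef
  -- Two expressions for V(b): the relation b g(G,·) = 2βcθ evaluated at V, and `der_V_b`.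
  have hbw : b * (2 * β * w - (u - 8 * β ^ 2 * c * l - 24 * β ^ 4 * c ^ 2 +
      8 * β ^ 3 * c * φ)) = 0 := by
    have := hG V
    rw [θ_apply] at this
    linear_combination 2 * β * this + hV
  have hβc : ∀ a : A, β * a = 0 → a = 0 := fun a h ↦ hβ.mul_right_eq_zero.1 h
  -- |fX|² is c times the squared length of the part of X orthogonal to ξ, so cancelling |fX|²
  -- cancels c.
  have hcc : ∀ a : A, c * a = 0 → a = 0 := fun a h ↦ hf _ fun X ↦ by
    rw [g_f, C.f_f, map_smul, map_sub, map_smul, smul_eq_mul]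
    linear_combination (L.g X X - L.g K.ξ X * L.g X K.ξ) * h
  have hGb : 2 * β * c * L.der G b = b * u := by
    have := hG G
    rw [θ_apply, hηG] at this
    linear_combination -this
  have hGu := hu G
  rw [hηG] at hGu
  have hGφ : L.der G φ = u := hφ G
  have hVu := hu V
  rw [← hwdef, ← hφdef] at hVu
  have d1 := congrArg (L.der G) hbw
  simp only [der_mul, map_sub, map_add, map_zero, h2, h8, h24, K.der_β, S.der_l, C.der_c, pow_succ,
    pow_zero, one_mul, hGφ, hGu] at d1
  -- G applied to `hbw`: `hw` replaces G(w) by terms in V(u), and the w inside V(u) is removed by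
  -- `hbw` itself.
  have k1 : b ^ 2 * ((u - 8 * β ^ 2 * c ^ 2 * b) * (l - β * φ - 3 * β ^ 2 * c) -
      48 * β ^ 4 * c ^ 3 * b) = 0 := by
    refine L.natCast_cancel 2 _ two_ne_zero (hβc _ ?_)
    push_cast
    linear_combination b * d1 - (L.der G b + 2 * β * b ^ 2 * c) * hbw - b ^ 2 * β * (hw + hVu)
  have d2 := congrArg (L.der G) k1
  simp only [der_mul, map_sub, map_zero, h3, h8, h48, K.der_β, S.der_l, C.der_c, pow_succ,
    pow_zero, one_mul, hGφ, hGu] at d2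
  -- G kills u − 8β²c²b, because 2βcG(b) = bu; so only φ and the last term of `k1` are
  -- differentiated, and φ disappears.
  have k2 : b ^ 3 * ((u + 16 * β ^ 2 * c ^ 2 * b) * u) = 0 := by
    refine hβc _ ?_
    linear_combination -b * d2 + 2 * L.der G b * k1 -
      b ^ 3 * (4 * β * c * (l - β * φ - 3 * β ^ 2 * c) + 24 * β ^ 3 * c ^ 2) * hGb
  have d3 := congrArg (L.der G) k2
  simp only [der_mul, map_add, map_zero, h16, K.der_β, C.der_c, pow_succ, pow_zero, one_mul,
    hGu] at d3
  -- G(u) is a multiple of u, and G(u + 16β²c²b) = 12βcbu; modulo `k2` only 12βc b⁵u² remains.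
  have k3 : b ^ 5 * u ^ 2 = 0 := by
    refine L.natCast_cancel 12 _ (by norm_num) (hβc _ (hcc _ ?_))
    push_cast
    linear_combination b * d3 - (3 * L.der G b + 4 * β * b ^ 2 * c) * k2 -
      8 * β * b ^ 4 * c * u * hGb
  have k4 : b * u = 0 := by
    refine pow_eq_zero_iff (n := 5) (by norm_num) |>.1 ?_
    linear_combination u ^ 3 * k3
  refine hpos _ ?_
  simp only [map_smul, LinearMap.smul_apply, smul_eq_mul]
  linear_combination b * k4

end RiemannianCalculus.Kenmotsu

/-! ### Smooth vector fields as a module, local frames and traces. -/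

section SmoothFields

variable {E : Type*} [NormedAddCommGroup E] [NormedSpace ℝ E]
  {M : Type*} [TopologicalSpace M] [ChartedSpace E M] [IsManifold 𝓘(ℝ, E) ∞ M]

/-- The ring of smooth functions on `M`. -/
abbrev SmoothFun (E : Type*) [NormedAddCommGroup E] [NormedSpace ℝ E]
    (M : Type*) [TopologicalSpace M] [ChartedSpace E M] :=
  ContMDiffMap 𝓘(ℝ, E) 𝓘(ℝ, ℝ) M ℝ ∞

/-- The smooth vector fields on `M`. -/
abbrev SmoothField (E : Type*) [NormedAddCommGroup E] [NormedSpace ℝ E]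
    (M : Type*) [TopologicalSpace M] [ChartedSpace E M] [IsManifold 𝓘(ℝ, E) ∞ M] :=
  ContMDiffSection 𝓘(ℝ, E) E ∞ (fun x : M ↦ TangentSpace 𝓘(ℝ, E) x)

namespace SmoothField

noncomputable instance : SMul (SmoothFun E M) (SmoothField E M) where
  smul a X := ⟨fun y ↦ a y • X y, a.contMDiff.smul_section X.contMDiff⟩

theorem smul_apply (a : SmoothFun E M) (X : SmoothField E M) (y : M) : (a • X) y = a y • X y := rfl

theorem add_apply (X Y : SmoothField E M) (y : M) : (X + Y) y = X y + Y y := rfl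

theorem sub_apply (X Y : SmoothField E M) (y : M) : (X - Y) y = X y - Y y := rfl

noncomputable instance : Module (SmoothFun E M) (SmoothField E M) where
  one_smul X := by ext y; exact one_smul ℝ (X y)
  mul_smul a b X := by ext y; exact mul_smul (a y) (b y) (X y)
  smul_zero a := by ext y; exact smul_zero (a y)
  smul_add a X Y := by ext y; exact smul_add (a y) (X y) (Y y)
  add_smul a b X := by ext y; exact add_smul (a y) (b y) (X y)
  zero_smul X := by ext y; exact zero_smul ℝ (X y)

theorem sum_apply {ι : Type*} (s : Finset ι) (X : ι → SmoothField E M) (y : M) :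
    (∑ i ∈ s, X i) y = ∑ i ∈ s, X i y :=
  map_sum (⟨⟨fun X : SmoothField E M ↦ X y, rfl⟩, fun _ _ ↦ rfl⟩ :
    SmoothField E M →+ TangentSpace 𝓘(ℝ, E) y) X s

theorem mem_baseSet (x : M) :
    x ∈ (trivializationAt E (fun x : M ↦ TangentSpace 𝓘(ℝ, E) x) x).baseSet :=
  FiberBundle.mem_baseSet_trivializationAt' x

theorem contMDiffOn_localExt {x : M} (u : TangentSpace 𝓘(ℝ, E) x) :
    ContMDiffOn 𝓘(ℝ, E) (𝓘(ℝ, E).prod 𝓘(ℝ, E)) ∞ (T% (SmoothMetric.localExt u))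
      (trivializationAt E (fun x : M ↦ TangentSpace 𝓘(ℝ, E) x) x).baseSet := by
  let t := trivializationAt E (fun x : M ↦ TangentSpace 𝓘(ℝ, E) x) x
  rw [t.contMDiffOn_section_baseSet_iff]
  refine (contMDiffOn_const (c := t.continuousLinearMapAt ℝ x u)).congr fun y hy ↦ ?_
  change (t ⟨y, t.symmL ℝ y (t.continuousLinearMapAt ℝ x u)⟩).2 = _
  rw [t.symmL_apply hy]
  exact congrArg Prod.snd (t.apply_mk_symm hy _)

variable [FiniteDimensional ℝ E] [T2Space M]

/-- A bump function at `x` supported in the domain of the preferred chart. -/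
noncomputable def bump (x : M) : SmoothBumpFunction 𝓘(ℝ, E) x := Classical.arbitrary _

theorem tsupport_bump (x : M) : tsupport (bump (E := E) x) ⊆
    (trivializationAt E (fun x : M ↦ TangentSpace 𝓘(ℝ, E) x) x).baseSet :=
  (bump x).tsupport_subset_chartAt_source

theorem bump_eq_zero {x y : M}
    (hy : y ∉ (trivializationAt E (fun x : M ↦ TangentSpace 𝓘(ℝ, E) x) x).baseSet) :
    bump (E := E) x y = 0 :=
  image_eq_zero_of_notMem_tsupport fun h ↦ hy (tsupport_bump x h)

/-- The bump function at `x` as an element of the ring of smooth functions. -/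
noncomputable def bumpFun (x : M) : SmoothFun E M :=
  ⟨fun y ↦ bump (E := E) x y, (bump x).contMDiff⟩

theorem bumpFun_self (x : M) : bumpFun (E := E) x x = 1 := (bump x).eq_one

/-- A global smooth vector field which agrees near `x` with the local extension of `u`. -/
noncomputable def ext {x : M} (u : TangentSpace 𝓘(ℝ, E) x) : SmoothField E M where
  toFun := (fun y ↦ bump (E := E) x y) • SmoothMetric.localExt u
  contMDiff_toFun := ContMDiffOn.smul_section_of_tsupport (bump x).contMDiff.contMDiffOn
    (Bundle.Trivialization.open_baseSet _) (tsupport_bump x) (contMDiffOn_localExt u)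

theorem ext_apply {x : M} (u : TangentSpace 𝓘(ℝ, E) x) (y : M) :
    ext u y = bump (E := E) x y • SmoothMetric.localExt u y := rfl

theorem ext_self {x : M} (u : TangentSpace 𝓘(ℝ, E) x) : ext u x = u := by
  rw [ext_apply, (bump x).eq_one, one_smul, SmoothMetric.localExt_self]

theorem ext_add {x : M} (u v : TangentSpace 𝓘(ℝ, E) x) : ext (u + v) = ext u + ext v := by
  ext y
  rw [add_apply, ext_apply, SmoothMetric.localExt_add]
  exact smul_add _ _ _

theorem ext_smul {x : M} (c : ℝ) (u : TangentSpace 𝓘(ℝ, E) x) :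
    ext (c • u) = algebraMap ℝ (SmoothFun E M) c • ext u := by
  ext y
  rw [smul_apply, ext_apply, SmoothMetric.localExt_smul]
  exact smul_comm _ _ _

theorem ext_eventuallyEq {x : M} (u : TangentSpace 𝓘(ℝ, E) x) :
    ∀ᶠ y in 𝓝 x, ext u y = SmoothMetric.localExt u y := by
  filter_upwards [(bump (E := E) x).eventuallyEq_one] with y hy
  rw [ext_apply, hy]
  exact one_smul ℝ _

/-- The coefficients, in a frame near `x`, of vector fields multiplied by a bump function. -/
noncomputable def coeff (x : M) (i : Fin (Module.finrank ℝ E)) :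
    SmoothField E M →ₗ[SmoothFun E M] SmoothFun E M where
  toFun X := ⟨fun y ↦ bump (E := E) x y *
      (trivializationAt E (fun x : M ↦ TangentSpace 𝓘(ℝ, E) x) x).localFrameCoeff 𝓘(ℝ, E)
        (Module.finBasis ℝ E) i y (X y), by
    refine contMDiff_of_tsupport fun y hy ↦ ?_
    refine (bump x).contMDiffAt.mul (contMDiffAt_localFrameCoeff _ (tsupport_bump x ?_)
      (X.contMDiff y) i)
    exact closure_mono (Function.support_mul_subset_left _ _) hy⟩
  map_add' X Y := by
    ext y
    change bump (E := E) x y * _ = bump (E := E) x y * _ + bump (E := E) x y * _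
    rw [add_apply, map_add, mul_add]
  map_smul' a X := by
    ext y
    change bump (E := E) x y * _ = a y * (bump (E := E) x y * _)
    rw [smul_apply, map_smul, smul_eq_mul]
    ring

theorem coeff_apply (x : M) (i : Fin (Module.finrank ℝ E)) (X : SmoothField E M) (y : M) :
    coeff x i X y = bump (E := E) x y *
      (trivializationAt E (fun x : M ↦ TangentSpace 𝓘(ℝ, E) x) x).localFrameCoeff 𝓘(ℝ, E)
        (Module.finBasis ℝ E) i y (X y) := rfl

/-- A frame of vector fields near `x`. -/
noncomputable def frame (x : M) (i : Fin (Module.finrank ℝ E)) : SmoothField E M :=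
  ext ((trivializationAt E (fun x : M ↦ TangentSpace 𝓘(ℝ, E) x) x).basisAt
    (Module.finBasis ℝ E) (mem_baseSet x) i)

theorem frame_apply (x : M) (i : Fin (Module.finrank ℝ E)) (y : M) :
    frame x i y = bump (E := E) x y •
      (trivializationAt E (fun x : M ↦ TangentSpace 𝓘(ℝ, E) x) x).localFrame
        (Module.finBasis ℝ E) i y := by
  rw [frame, ext_apply]
  let t := trivializationAt E (fun x : M ↦ TangentSpace 𝓘(ℝ, E) x) x
  by_cases hy : y ∈ t.baseSet
  · congr 1
    change t.symmL ℝ y (t.continuousLinearMapAt ℝ x _) = _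
    rw [t.localFrame_apply_of_mem_baseSet _ hy]
    have h : t.continuousLinearMapAt ℝ x (t.basisAt (Module.finBasis ℝ E) (mem_baseSet x) i) =
        Module.finBasis ℝ E i := by
      have h' : t.basisAt (Module.finBasis ℝ E) (mem_baseSet x) i =
          t.symmL ℝ x (Module.finBasis ℝ E i) := by
        rw [t.symmL_apply (mem_baseSet x)]
        simp [Bundle.Trivialization.basisAt]
      rw [h', t.continuousLinearMapAt_symmL (R := ℝ) (mem_baseSet x)]
    rw [h]
    simp [Bundle.Trivialization.basisAt, hy]
  · rw [bump_eq_zero hy, zero_smul, zero_smul]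

/-- Coefficient and frame each carry a bump factor, hence the square. Both sides vanish off the
trivialising set, so the identity is global. -/
theorem sum_coeff_smul_frame (x : M) (X : SmoothField E M) :
    ∑ i, coeff x i X • frame x i = (bumpFun (E := E) x * bumpFun x) • X := by
  ext y
  rw [sum_apply]
  simp only [smul_apply, coeff_apply, frame_apply]
  by_cases hy : y ∈ (trivializationAt E (fun x : M ↦ TangentSpace 𝓘(ℝ, E) x) x).baseSet
  · conv_rhs => rw [Bundle.Trivialization.eq_sum_localFrameCoeff_smul (I := 𝓘(ℝ, E))
      (b := Module.finBasis ℝ E) (s := fun y ↦ X y) hy]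
    rw [Finset.smul_sum]
    refine Finset.sum_congr rfl fun i _ ↦ ?_
    change _ = (bump (E := E) x y * bump (E := E) x y) • _
    rw [smul_smul, smul_smul]
    congr 1
    ring
  · have h : (bumpFun (E := E) x * bumpFun x : SmoothFun E M) y = 0 := by
      change bump (E := E) x y * bump (E := E) x y = 0
      rw [bump_eq_zero hy, zero_mul]
    rw [h, zero_smul]
    exact Finset.sum_eq_zero fun i _ ↦ by rw [bump_eq_zero hy, zero_mul, zero_smul]

theorem bumpFun_mul_self (x : M) : (bumpFun (E := E) x * bumpFun x : SmoothFun E M) x = 1 := by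
  change bumpFun x x * bumpFun x x = 1
  rw [bumpFun_self, one_mul]

theorem coeff_eq_zero {x : M} {X : SmoothField E M} (h : X x = 0) (i) : coeff x i X x = 0 := by
  rw [coeff_apply, h, map_zero, mul_zero]

theorem coeff_frame (x : M) (i j) : coeff x i (frame (E := E) x j) x = if j = i then 1 else 0 := by
  rw [coeff_apply, frame_apply, (bump x).eq_one, one_mul, one_smul,
    Bundle.Trivialization.localFrameCoeff_apply_of_mem_baseSet _ _ (mem_baseSet x)
      (fun y ↦ (trivializationAt E (fun x : M ↦ TangentSpace 𝓘(ℝ, E) x) x).localFrame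
        (Module.finBasis ℝ E) j y),
    Bundle.Trivialization.localFrame_apply_of_mem_baseSet _ _ (mem_baseSet x),
    Module.Basis.repr_self, Finsupp.single_apply]

/-- Tensoriality: maps which are linear over smooth functions are pointwise. -/
theorem eq_zero_of_tensorial {F : Type*} [AddCommGroup F] [Module ℝ F] {x : M}
    (Φ : SmoothField E M →+ F) (hΦ : ∀ (a : SmoothFun E M) (X : SmoothField E M), Φ (a • X) = a x • Φ X) {X : SmoothField E M}
    (h : X x = 0) : Φ X = 0 := by
  have h1 := congrArg Φ (sum_coeff_smul_frame x X)
  rw [map_sum, hΦ, bumpFun_mul_self, one_smul] at h1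
  rw [← h1]
  exact Finset.sum_eq_zero fun i _ ↦ by rw [hΦ, coeff_eq_zero h, zero_smul]

theorem eq_of_tensorial {F : Type*} [AddCommGroup F] [Module ℝ F] {x : M}
    (Φ : SmoothField E M →+ F) (hΦ : ∀ (a : SmoothFun E M) (X : SmoothField E M), Φ (a • X) = a x • Φ X) {X Y : SmoothField E M}
    (h : X x = Y x) : Φ X = Φ Y := by
  rw [← sub_eq_zero, ← map_sub]
  exact eq_zero_of_tensorial Φ hΦ (by rw [sub_apply, h, sub_self])

theorem apply_eq (T : SmoothField E M →ₗ[SmoothFun E M] SmoothField E M) {x : M}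
    {X Y : SmoothField E M} (h : X x = Y x) : T X x = T Y x :=
  eq_of_tensorial (⟨⟨fun X ↦ T X x, by rw [map_zero]; rfl⟩, fun X Y ↦ by
    change T (X + Y) x = _; rw [map_add]; rfl⟩ : SmoothField E M →+ TangentSpace 𝓘(ℝ, E) x)
    (fun a X ↦ by change T (a • X) x = _; rw [map_smul]; rfl) h

theorem form_apply_eq (T : SmoothField E M →ₗ[SmoothFun E M] SmoothFun E M) {x : M}
    {X Y : SmoothField E M} (h : X x = Y x) : T X x = T Y x :=
  eq_of_tensorial (⟨⟨fun X ↦ T X x, by rw [map_zero]; rfl⟩, fun X Y ↦ by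
    change T (X + Y) x = _; rw [map_add]; rfl⟩ : SmoothField E M →+ ℝ)
    (fun a X ↦ by change T (a • X) x = _; rw [map_smul]; rfl) h

/-- The endomorphism of the tangent space at `x` induced by an endomorphism of the module of
vector fields. -/
noncomputable def endAt (x : M) (T : SmoothField E M →ₗ[SmoothFun E M] SmoothField E M) :
    TangentSpace 𝓘(ℝ, E) x →ₗ[ℝ] TangentSpace 𝓘(ℝ, E) x where
  toFun u := T (ext u) x
  map_add' u v := by rw [ext_add, map_add]; rfl
  map_smul' c u := by rw [ext_smul, map_smul]; rfl

theorem endAt_apply (x : M) (T : SmoothField E M →ₗ[SmoothFun E M] SmoothField E M)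
    (u : TangentSpace 𝓘(ℝ, E) x) : endAt x T u = T (ext u) x := rfl

/-- The linear form on the tangent space at `x` induced by a form on the module of vector
fields. -/
noncomputable def formAt (x : M) (θ : SmoothField E M →ₗ[SmoothFun E M] SmoothFun E M) :
    TangentSpace 𝓘(ℝ, E) x →ₗ[ℝ] ℝ where
  toFun u := θ (ext u) x
  map_add' u v := by rw [ext_add, map_add]; rfl
  map_smul' c u := by
    change θ (ext (c • u)) x = c • θ (ext u) x
    rw [ext_smul, map_smul]; rfl

theorem formAt_apply (x : M) (θ : SmoothField E M →ₗ[SmoothFun E M] SmoothFun E M)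
    (X : SmoothField E M) : formAt x θ (X x) = θ X x := form_apply_eq θ (ext_self _)

/-- Near x the bump function is 1, so the frame is a basis of each nearby tangent space. This makes
the pointwise trace a smooth function. -/
theorem trace_endAt (x : M) (T : SmoothField E M →ₗ[SmoothFun E M] SmoothField E M) :
    ∀ᶠ y in 𝓝 x, LinearMap.trace ℝ (TangentSpace 𝓘(ℝ, E) y) (endAt y T) =
      (∑ i, coeff x i (T (frame x i)) : SmoothFun E M) y := by
  let t := trivializationAt E (fun x : M ↦ TangentSpace 𝓘(ℝ, E) x) x
  filter_upwards [(bump (E := E) x).eventuallyEq_one,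
    t.open_baseSet.mem_nhds (mem_baseSet x)] with y hy hyt
  have hs : (∑ i, coeff x i (T (frame x i)) : SmoothFun E M) y =
      ∑ i, coeff x i (T (frame x i)) y :=
    map_sum (⟨⟨fun a : SmoothFun E M ↦ a y, rfl⟩, fun _ _ ↦ rfl⟩ : SmoothFun E M →+ ℝ) _ _
  rw [hs, LinearMap.trace_eq_matrix_trace ℝ (t.basisAt (Module.finBasis ℝ E) hyt), Matrix.trace]
  refine Finset.sum_congr rfl fun i _ ↦ ?_
  have h : ext (t.basisAt (Module.finBasis ℝ E) hyt i) y = frame x i y := by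
    rw [ext_self, frame_apply, hy, t.localFrame_apply_of_mem_baseSet _ hyt]
    exact (one_smul ℝ _).symm
  rw [Matrix.diag_apply, LinearMap.toMatrix_apply, endAt_apply, apply_eq T h, coeff_apply, hy,
    Pi.one_apply, one_mul,
    Bundle.Trivialization.localFrameCoeff_apply_of_mem_baseSet _ _ hyt
      (fun y ↦ T (frame x i) y)]

/-- The trace of an endomorphism of the module of vector fields. -/
noncomputable def tr :
    (SmoothField E M →ₗ[SmoothFun E M] SmoothField E M) →ₗ[SmoothFun E M] SmoothFun E M where
  toFun T := ⟨fun y ↦ LinearMap.trace ℝ (TangentSpace 𝓘(ℝ, E) y) (endAt y T), fun x ↦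
    ((∑ i, coeff x i (T (frame x i)) : SmoothFun E M).contMDiff x).congr_of_eventuallyEq
      (trace_endAt x T)⟩
  map_add' T T' := by
    ext y
    change LinearMap.trace ℝ _ _ = LinearMap.trace ℝ _ _ + LinearMap.trace ℝ _ _
    rw [← map_add]
    rfl
  map_smul' a T := by
    ext y
    change LinearMap.trace ℝ _ _ = a y * LinearMap.trace ℝ _ _
    rw [← smul_eq_mul, ← map_smul]
    rfl

theorem tr_apply (T : SmoothField E M →ₗ[SmoothFun E M] SmoothField E M) (y : M) :
    tr T y = LinearMap.trace ℝ (TangentSpace 𝓘(ℝ, E) y) (endAt y T) := rfl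

theorem tr_smulRight (θ : SmoothField E M →ₗ[SmoothFun E M] SmoothFun E M)
    (Z : SmoothField E M) : tr (θ.smulRight Z) = θ Z := by
  ext y
  have h : endAt y (θ.smulRight Z) = (formAt y θ).smulRight (Z y) := rfl
  have : FiniteDimensional ℝ (TangentSpace 𝓘(ℝ, E) y) := inferInstanceAs (FiniteDimensional ℝ E)
  rw [tr_apply, h, LinearMap.trace_smulRight, formAt_apply]

theorem tr_id (y : M) : (tr LinearMap.id : SmoothFun E M) y = Module.finrank ℝ E := by
  have h : endAt (E := E) y LinearMap.id = LinearMap.id := LinearMap.ext fun u ↦ ext_self u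
  have : FiniteDimensional ℝ (TangentSpace 𝓘(ℝ, E) y) := inferInstanceAs (FiniteDimensional ℝ E)
  rw [tr_apply, h, LinearMap.trace_id]
  rfl

end SmoothField

end SmoothFields

/-! ### Derivations and their compatibility with traces. -/

section SmoothCalculus

variable {E : Type*} [NormedAddCommGroup E] [NormedSpace ℝ E]
  {M : Type*} [TopologicalSpace M] [ChartedSpace E M]

namespace SmoothField

/-- Evaluation of smooth functions at a point. -/
noncomputable def eval (x : M) : SmoothFun E M →+* ℝ where
  toFun a := a x
  map_one' := rfl
  map_mul' _ _ := rfl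
  map_zero' := rfl
  map_add' _ _ := rfl

theorem eval_apply (x : M) (a : SmoothFun E M) : eval x a = a x := rfl

theorem mdiff_fun (a : SmoothFun E M) (x : M) : MDiffAt a x :=
  (a.contMDiff x).mdifferentiableAt (by simp)

variable [IsManifold 𝓘(ℝ, E) ∞ M]

theorem mdiff (X : SmoothField E M) (x : M) : MDiffAt (T% (X : VField E M)) x :=
  (X.contMDiff x).mdifferentiableAt (by simp)

variable [FiniteDimensional ℝ E]

/-- The derivation of the ring of smooth functions given by a vector field. -/
noncomputable def der :
    SmoothField E M →ₗ[SmoothFun E M] Derivation ℤ (SmoothFun E M) (SmoothFun E M) where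
  toFun X := Derivation.mk'
    (AddMonoidHom.toIntLinearMap
      ⟨⟨fun a ↦ ⟨fun y ↦ d% a y (X y),
        fun y ↦ SmoothMetric.contMDiffAt_mvfderiv (a.contMDiff y) (X.contMDiff y)⟩, by
        ext y
        change d% (0 : M → ℝ) y (X y) = 0
        rw [mvfderiv_zero]
        rfl⟩, fun a b ↦ by
        ext y
        change d% (a + b : M → ℝ) y (X y) = d% a y (X y) + d% b y (X y)
        rw [mvfderiv_add (mdiff_fun a y) (mdiff_fun b y)]
        rfl⟩)
    fun a b ↦ by
      ext y
      change d% (a * b : M → ℝ) y (X y) = a y * d% b y (X y) + b y * d% a y (X y)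
      rw [mvfderiv_mul (mdiff_fun a y) (mdiff_fun b y)]
      rfl
  map_add' X Y := by
    ext a y
    exact map_add (d% a y) (X y) (Y y)
  map_smul' c X := by
    ext a y
    exact map_smul (d% a y) (c y) (X y)

theorem der_apply (X : SmoothField E M) (a : SmoothFun E M) (y : M) :
    der X a y = d% a y (X y) := rfl

theorem der_congr (X : SmoothField E M) {a b : SmoothFun E M} {x : M}
    (h : (a : M → ℝ) =ᶠ[𝓝 x] b) : der X a x = der X b x := by
  have : d% a x = d% b x := by
    unfold mvfderiv
    rw [h.mfderiv_eq, h.eq_of_nhds]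
  rw [der_apply, der_apply, this]

variable [T2Space M]

theorem der_bumpFun_sq (X : SmoothField E M) (x : M) :
    der X (bumpFun x * bumpFun x) x = 0 := by
  have h : ((bumpFun x * bumpFun x : SmoothFun E M) : M → ℝ) =ᶠ[𝓝 x] (1 : SmoothFun E M) := by
    filter_upwards [(bump (E := E) x).eventuallyEq_one] with y hy
    change bump (E := E) x y * bump (E := E) x y = 1
    rw [hy, Pi.one_apply, one_mul]
  rw [der_congr X h, Derivation.map_one_eq_zero]
  rfl

theorem coeff_tensor (x : M) (T : SmoothField E M →ₗ[SmoothFun E M] SmoothField E M)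
    (Z : SmoothField E M) (i) :
    coeff x i (T Z) x = ∑ j, coeff x j Z x * coeff x i (T (frame x j)) x := by
  have h := congrArg (fun W ↦ eval x (coeff x i (T W))) (sum_coeff_smul_frame x Z)
  simp only [map_sum, map_smul, smul_eq_mul, map_mul, eval_apply, bumpFun_self, one_mul] at h
  exact h.symm

/-- Apply D to the frame expansion and read off a coefficient at x; the squared bump is 1 near x and
contributes no derivative. -/
theorem der_coeff (x : M) (X : SmoothField E M) (D : SmoothField E M →+ SmoothField E M)
    (hD : ∀ (a : SmoothFun E M) Z, D (a • Z) = a • D Z + der X a • Z) (Z : SmoothField E M) (i) :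
    der X (coeff x i Z) x =
      coeff x i (D Z) x - ∑ j, coeff x j Z x * coeff x i (D (frame x j)) x := by
  have h := congrArg (fun W ↦ eval x (coeff x i (D W))) (sum_coeff_smul_frame x Z)
  simp only [map_sum, hD, map_add, map_smul, smul_eq_mul] at h
  simp only [map_mul, eval_apply, der_bumpFun_sq, bumpFun_self, coeff_frame] at h
  rw [Finset.sum_add_distrib] at h
  simp only [mul_ite, mul_one, mul_zero, Finset.sum_ite_eq', Finset.mem_univ, if_true, one_mul,
    zero_mul, add_zero] at h
  linarith

/-- In the frame, X(tr T) and tr[D, T] differ by the trace of the commutator of T with the matrix of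
D, which is zero. -/
theorem der_tr (X : SmoothField E M) (D : SmoothField E M →+ SmoothField E M)
    (hD : ∀ (a : SmoothFun E M) Z, D (a • Z) = a • D Z + der X a • Z)
    (T T' : SmoothField E M →ₗ[SmoothFun E M] SmoothField E M)
    (hT : ∀ Z, T' Z = D (T Z) - T (D Z)) : der X (tr T) = tr T' := by
  ext x
  have hs (U : SmoothField E M →ₗ[SmoothFun E M] SmoothField E M) :
      (∑ i, coeff x i (U (frame x i)) : SmoothFun E M) x = ∑ i, coeff x i (U (frame x i)) x :=
    map_sum (eval x) _ _
  have h1 : ((tr T : SmoothFun E M) : M → ℝ) =ᶠ[𝓝 x]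
      (∑ i, coeff x i (T (frame x i)) : SmoothFun E M) := trace_endAt x T
  have h2 : tr T' x = ∑ i, coeff x i (T' (frame x i)) x :=
    (trace_endAt x T').self_of_nhds.trans (hs T')
  rw [der_congr X h1, h2, map_sum]
  change eval x _ = _
  simp only [map_sum, eval_apply]
  have h3 : ∀ i, coeff x i (T' (frame x i)) x = coeff x i (D (T (frame x i))) x -
      ∑ j, coeff x j (D (frame x i)) x * coeff x i (T (frame x j)) x := by
    intro i
    rw [hT, map_sub, ← coeff_tensor]
    rfl
  simp only [h3, der_coeff x X D hD, Finset.sum_sub_distrib]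
  congr 1
  rw [Finset.sum_comm]
  exact Finset.sum_congr rfl fun i _ ↦ Finset.sum_congr rfl fun j _ ↦ mul_comm _ _

end SmoothField

end SmoothCalculus

/-! ### The Levi-Civita connection as a Riemannian calculus. -/

section SmoothRiemannianCalculus

variable {E : Type*} [NormedAddCommGroup E] [NormedSpace ℝ E]
  {M : Type*} [TopologicalSpace M] [ChartedSpace E M] [IsManifold 𝓘(ℝ, E) ∞ M]

namespace SmoothMetric

open SmoothField

theorem inner_self_eq_zero (g : SmoothMetric E M) {x : M} {u : TangentSpace 𝓘(ℝ, E) x}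
    (h : g.inner x u u = 0) : u = 0 := by
  by_contra h0
  exact (g.pos x u h0).ne' h

variable [FiniteDimensional ℝ E]

/-- The Levi-Civita connection on smooth vector fields. -/
noncomputable def nabla (g : SmoothMetric E M) :
    SmoothField E M →ₗ[SmoothFun E M] SmoothField E M →+ SmoothField E M where
  toFun X :=
    ⟨⟨fun Y ↦ ⟨fun y ↦ g.leviCivita Y y (X y),
        fun y ↦ g.contMDiffAt_leviCivita (X.contMDiff y) (Y.contMDiff y)⟩, by
        ext y
        change g.leviCivita (0 : VField E M) y (X y) = 0
        have h := g.leviCivita.isCovariantDerivativeOnUniv.add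
          (mdiff (0 : SmoothField E M) y) (mdiff (0 : SmoothField E M) y)
        have h0 : ((0 : SmoothField E M) : VField E M) = 0 := rfl
        rw [h0, add_zero, left_eq_add] at h
        rw [h]
        rfl⟩, fun Y Y' ↦ by
        ext y
        exact congrArg (fun T ↦ T (X y))
          (g.leviCivita.isCovariantDerivativeOnUniv.add (mdiff Y y) (mdiff Y' y))⟩
  map_add' X X' := by
    ext Y y
    exact map_add (g.leviCivita Y y) (X y) (X' y)
  map_smul' c X := by
    ext Y y
    exact map_smul (g.leviCivita Y y) (c y) (X y)

theorem nabla_smul (g : SmoothMetric E M) (X : SmoothField E M) (a : SmoothFun E M)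
    (Y : SmoothField E M) : g.nabla X (a • Y) = a • g.nabla X Y + der X a • Y := by
  ext y
  exact congrArg (fun T ↦ T (X y))
    (g.leviCivita.isCovariantDerivativeOnUniv.leibniz (mdiff Y y) (mdiff_fun a y))

/-- The metric as a bilinear form on smooth vector fields. -/
noncomputable def form (g : SmoothMetric E M) :
    SmoothField E M →ₗ[SmoothFun E M] SmoothField E M →ₗ[SmoothFun E M] SmoothFun E M :=
  LinearMap.mk₂ (SmoothFun E M)
    (fun X Y ↦ ⟨fun y ↦ g.inner y (X y) (Y y),
      fun y ↦ g.contMDiffAt_pair (X.contMDiff y) (Y.contMDiff y)⟩)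
    (fun X X' Y ↦ by
      ext y
      change g.inner y (X y + X' y) (Y y) = g.inner y (X y) (Y y) + g.inner y (X' y) (Y y)
      rw [map_add, _root_.add_apply])
    (fun c X Y ↦ by
      ext y
      change g.inner y (c y • X y) (Y y) = c y * g.inner y (X y) (Y y)
      rw [map_smul, _root_.smul_apply, smul_eq_mul])
    (fun X Y Y' ↦ by
      ext y
      exact map_add (g.inner y (X y)) (Y y) (Y' y))
    (fun c X Y ↦ by
      ext y
      exact map_smul (g.inner y (X y)) (c y) (Y y))

/-- The gradient of a smooth function. -/
noncomputable def grad (g : SmoothMetric E M) (a : SmoothFun E M) : SmoothField E M where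
  toFun y := (g.flat y).symm (d% a y)
  contMDiff_toFun y := g.contMDiffAt_of_pair fun Z hZ ↦ by
    have h : g.pair (fun y ↦ (g.flat y).symm (d% a y)) Z = fun y ↦ d% a y (Z y) := by
      ext y
      exact g.inner_flat_symm y _ _
    rw [h]
    exact contMDiffAt_mvfderiv (a.contMDiff y) hZ

theorem nabla_sub_nabla (g : SmoothMetric E M) (X Y : SmoothField E M) (y : M) :
    (g.nabla X Y - g.nabla Y X) y = mlieBracket 𝓘(ℝ, E) X Y y :=
  (CovariantDerivative.torsion_eq_zero_iff _).1 g.leviCivita_torsion (mdiff X y) (mdiff Y y)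

theorem nabla_jacobi (g : SmoothMetric E M) (X Y Z : SmoothField E M) :
    g.nabla X (g.nabla Y Z - g.nabla Z Y) - g.nabla (g.nabla Y Z - g.nabla Z Y) X =
      (g.nabla (g.nabla X Y - g.nabla Y X) Z - g.nabla Z (g.nabla X Y - g.nabla Y X)) +
        (g.nabla Y (g.nabla X Z - g.nabla Z X) - g.nabla (g.nabla X Z - g.nabla Z X) Y) := by
  have : IsManifold 𝓘(ℝ, E) (minSmoothness ℝ 3) M := by
    rw [minSmoothness_of_isRCLikeNormedField]
    exact IsManifold.of_le (n := ∞) (WithTop.coe_le_coe.2 le_top)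
  have hs (X : SmoothField E M) (y : M) :
      CMDiffAt (minSmoothness ℝ 2) (T% (X : VField E M)) y := by
    rw [minSmoothness_of_isRCLikeNormedField]
    exact (X.contMDiff y).of_le (WithTop.coe_le_coe.2 le_top)
  have hb (X Y : SmoothField E M) :
      ((g.nabla X Y - g.nabla Y X : SmoothField E M) : VField E M) = mlieBracket 𝓘(ℝ, E) X Y :=
    funext (g.nabla_sub_nabla X Y)
  ext y
  rw [SmoothField.add_apply, nabla_sub_nabla, nabla_sub_nabla, nabla_sub_nabla, hb, hb, hb]
  exact leibniz_identity_mlieBracket_apply (hs X y) (hs Y y) (hs Z y)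

theorem leviCivita_congr (g : SmoothMetric E M) {Y Y' : VField E M} {x : M}
    (hY : CMDiffAt ∞ (T% Y) x) (hY' : CMDiffAt ∞ (T% Y') x) (h : ∀ᶠ y in 𝓝 x, Y y = Y' y) :
    g.leviCivita Y x = g.leviCivita Y' x :=
  g.leviCivita.isCovariantDerivativeOnUniv.congr_of_eventuallyEq
    (hY.mdifferentiableAt (by simp)) (hY'.mdifferentiableAt (by simp)) Filter.univ_mem h

/-- Jacobi for (X, Y, aZ) minus a times Jacobi for (X, Y, Z) leaves exactly the wanted identity
multiplied by Z; then choose Z nonzero at the point. If no such choice exists, X and Y vanish there.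
-/
theorem der_comm (g : SmoothMetric E M) (X Y : SmoothField E M) (a : SmoothFun E M) :
    der X (der Y a) - der Y (der X a) = der (g.nabla X Y) a - der (g.nabla Y X) a := by
  have key (Z : SmoothField E M) :
      (der X (der Y a) - der Y (der X a) - (der (g.nabla X Y) a - der (g.nabla Y X) a)) • Z = 0 := by
    have h1 := g.nabla_jacobi X Y (a • Z)
    have h2 := congrArg (a • ·) (g.nabla_jacobi X Y Z)
    have hl (b : SmoothFun E M) (U W : SmoothField E M) :
        g.nabla (b • U) W = b • g.nabla U W := by rw [map_smul]; rfl
    simp only [nabla_smul, hl, map_add, map_sub, AddMonoidHom.add_apply,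
      AddMonoidHom.sub_apply] at h1 h2
    linear_combination (norm := module) h1 - h2
  ext y
  by_cases hX : X y = 0 ∧ Y y = 0
  · change d% (der Y a) y (X y) - d% (der X a) y (Y y) =
      d% a y (g.leviCivita Y y (X y)) - d% a y (g.leviCivita X y (Y y))
    rw [hX.1, hX.2]
    simp only [map_zero]
  · obtain ⟨Z, hZ⟩ : ∃ Z : SmoothField E M, Z y ≠ 0 := by
      by_contra! h
      exact hX ⟨h X, h Y⟩
    have h := DFunLike.congr_fun (key Z) y
    exact sub_eq_zero.1 ((smul_eq_zero.1 h).resolve_right hZ)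

variable [T2Space M]

/-- The Riemannian calculus of smooth functions and smooth vector fields. -/
noncomputable def calculus (g : SmoothMetric E M) :
    RiemannianCalculus (SmoothFun E M) (SmoothField E M) where
  der := der
  nabla := g.nabla
  g := g.form
  grad := g.grad
  tr := tr
  nabla_smul := g.nabla_smul
  g_symm X Y := by
    ext y
    exact g.symm y _ _
  g_ext X Y h := by
    ext y
    refine sub_eq_zero.1 (g.inner_self_eq_zero (x := y) ?_)
    have := DFunLike.congr_fun (h (X - Y)) y
    have h1 : g.inner y (X y) ((X - Y) y) = g.inner y (Y y) ((X - Y) y) := this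
    change g.inner y (X y - Y y) ((X - Y) y) = 0
    rw [map_sub, _root_.sub_apply, h1, sub_self]
  der_g X Y Z := by
    ext y
    exact g.leviCivita_metric (mdiff X y) (mdiff Y y) (mdiff Z y)
  der_comm := g.der_comm
  jacobi := g.nabla_jacobi
  g_grad a X := by
    ext y
    exact g.inner_flat_symm y _ _
  natCast_cancel k a hk h := by
    ext y
    have h1 := congrArg (eval y) h
    rw [map_mul, map_natCast, map_zero] at h1
    exact (mul_eq_zero.1 h1).resolve_left (Nat.cast_ne_zero.2 hk)
  tr_smulRight := tr_smulRight
  tr_der := der_tr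

/-- Covariant derivatives and brackets depend only on germs, and the global extensions have the same
germs at x as the local ones. -/
theorem curvature_apply (g : SmoothMetric E M) {x : M} (u v w : TangentSpace 𝓘(ℝ, E) x) :
    g.curvature x u v w = g.calculus.R (ext u) (ext v) (ext w) x := by
  have hs (u : TangentSpace 𝓘(ℝ, E) x) := contMDiffAt_localExt u
  have he (u : TangentSpace 𝓘(ℝ, E) x) := (ext u).contMDiff x
  have h1 (u v w : TangentSpace 𝓘(ℝ, E) x) :
      g.leviCivita (fun y ↦ g.leviCivita (localExt w) y (localExt v y)) x u =
        g.leviCivita (fun y ↦ g.leviCivita (ext w) y (ext v y)) x u := by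
    refine congrArg (fun T ↦ T u) (g.leviCivita_congr (g.contMDiffAt_leviCivita (hs v) (hs w))
      (g.contMDiffAt_leviCivita (he v) (he w)) ?_)
    filter_upwards [ext_eventuallyEq v, (ext_eventuallyEq w).eventually_nhds,
      eventually_mdifferentiableAt (hs w)] with y h1 h2 h3
    rw [h1]
    exact congrArg (fun T ↦ T (localExt v y))
      (g.leviCivita.isCovariantDerivativeOnUniv.congr_of_eventuallyEq h3 (mdiff (ext w) y)
        Filter.univ_mem (h2.mono fun _ h ↦ h.symm))
  have h2 : mlieBracket 𝓘(ℝ, E) (localExt u) (localExt v) x =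
      (g.nabla (ext u) (ext v) - g.nabla (ext v) (ext u)) x := by
    rw [nabla_sub_nabla]
    exact Filter.EventuallyEq.mlieBracket_vectorField_eq
      ((ext_eventuallyEq u).mono fun _ h ↦ h.symm) ((ext_eventuallyEq v).mono fun _ h ↦ h.symm)
  have h3 := congrArg (fun T ↦ T ((g.nabla (ext u) (ext v) - g.nabla (ext v) (ext u)) x))
    (g.leviCivita_congr (hs w) (he w) ((ext_eventuallyEq w).mono fun _ h ↦ h.symm))
  rw [RiemannianCalculus.R_apply]
  change g.leviCivita _ x (localExt u x) - g.leviCivita _ x (localExt v x) -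
    g.leviCivita (localExt w) x _ = _
  rw [h1, h1, h2, h3, localExt_self, localExt_self]
  change _ = g.leviCivita _ x (ext u x) - g.leviCivita _ x (ext v x) - g.leviCivita _ x _
  rw [ext_self, ext_self]
  rfl

end SmoothMetric

end SmoothRiemannianCalculus

/-! ### Pointwise linear algebra of f. -/

section SkewEndomorphisms

variable {V : Type*} [AddCommGroup V] [Module ℝ V] {B : V →ₗ[ℝ] V →ₗ[ℝ] ℝ} {f : V →ₗ[ℝ] V} {ξ : V}

theorem exists_map_ne_zero_of_ker (hker : ∀ u, f u = 0 → u = B ξ u • ξ)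
    (hd : 1 < Module.finrank ℝ V) : ∃ u, f u ≠ 0 := by
  have : FiniteDimensional ℝ V := FiniteDimensional.of_finrank_pos (by lia)
  obtain ⟨u, hu, hu0⟩ := (Submodule.ne_bot_iff _).1
    (LinearMap.ker_ne_bot_of_finrank_lt (f := B ξ) (by rwa [Module.finrank_self]))
  refine ⟨u, fun h ↦ hu0 ?_⟩
  rw [hker u h, LinearMap.mem_ker.1 hu, zero_smul]

/-- If φ(p) ≠ 0, dimension at least four leaves a nonzero u killed by φ, B(ξ,·) and B(fp,·). The
wedge identity on (p, u, w) then gives fu = 0, so u is a multiple of ξ orthogonal to ξ. -/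
theorem eq_zero_of_wedge (hB : ∀ u, B u u = 0 → u = 0) (hker : ∀ u, f u = 0 → u = B ξ u • ξ)
    (hd : 3 < Module.finrank ℝ V) (φ : V →ₗ[ℝ] ℝ)
    (h : ∀ u v w, φ u * B (f v) w + φ v * B (f w) u + φ w * B (f u) v = 0) : φ = 0 := by
  have : FiniteDimensional ℝ V := FiniteDimensional.of_finrank_pos (by lia)
  ext p
  by_contra hp
  obtain ⟨u, hu, hu0⟩ := (Submodule.ne_bot_iff _).1 (LinearMap.ker_ne_bot_of_finrank_lt
    (f := φ.prod ((B ξ).prod (B (f p)))) (by simpa using hd))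
  simp only [LinearMap.mem_ker, LinearMap.prod_apply, Function.prod_apply, Prod.mk_eq_zero] at hu
  have h1 (w : V) : B (f u) w = 0 := by
    have h2 := h p u w
    rw [hu.1, hu.2.2, zero_mul, mul_zero, add_zero, add_zero] at h2
    exact (mul_eq_zero.1 h2).resolve_left hp
  apply hu0
  rw [hker u (hB _ (h1 _)), hu.2.1, zero_smul]

/-- For u orthogonal to ξ, the vectors u, fu, ξ form an orthogonal basis. Skewness makes f²u
orthogonal to fu and ξ, so f²u = su; as f² is symmetric, it equals s on all of the complement of ξ,
and its trace is 2s. -/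
theorem sq_eq_of_skew (hB : ∀ u, B u u = 0 → u = 0) (hs : ∀ u v, B u v = B v u)
    (hf : ∀ u v, B (f u) v = -B u (f v)) (hξ : B ξ ξ = 1) (hfξ : f ξ = 0)
    (hker : ∀ u, f u = 0 → u = B ξ u • ξ) (hd : Module.finrank ℝ V = 3) (w : V) :
    f (f w) = ((1 / 2) * LinearMap.trace ℝ V (f ∘ₗ f)) • (w - B ξ w • ξ) := by
  have : FiniteDimensional ℝ V := FiniteDimensional.of_finrank_pos (by lia)
  obtain ⟨u, hu, hu0⟩ := (Submodule.ne_bot_iff _).1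
    (LinearMap.ker_ne_bot_of_finrank_lt (f := B ξ) (by rw [Module.finrank_self]; lia))
  rw [LinearMap.mem_ker] at hu
  have hξf (v : V) : B ξ (f v) = 0 := by rw [← neg_eq_zero, ← hf, hfξ, map_zero]; rfl
  have hff (u : V) : B u (f u) = 0 := by
    have h := hf u u
    rw [hs] at h
    linarith
  have huf := hff u
  have hu1 : B u u ≠ 0 := fun h ↦ hu0 (hB u h)
  have hfu1 : B (f u) (f u) ≠ 0 := fun h ↦ hu0 (by rw [hker u (hB _ h), hu, zero_smul])
  let φ : V →ₗ[ℝ] ℝ × ℝ × ℝ := (B u).prod ((B (f u)).prod (B ξ))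
  have hφ : Function.Injective φ := by
    rw [LinearMap.injective_iff_surjective_of_finrank_eq_finrank (by simpa using hd)]
    rintro ⟨a, b, c⟩
    refine ⟨(a / B u u) • u + (b / B (f u) (f u)) • f u + c • ξ, ?_⟩
    simp only [φ, LinearMap.prod_apply, Function.prod_apply, map_add, map_smul, huf,
      hu, hξ, hξf, hs u ξ, hs (f u) ξ, hs (f u) u]
    simp [hu1, hfu1]
  obtain ⟨s, hs'⟩ : ∃ s, s = B u (f (f u)) / B u u := ⟨_, rfl⟩
  have hus : B u (f (f u)) = s * B u u := by rw [hs', div_mul_cancel₀ _ hu1]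
  have h1 : f (f u) = s • u := by
    refine hφ ?_
    simp only [φ, LinearMap.prod_apply, Function.prod_apply, map_smul, hus, hu, hξf, hs (f u) u,
      huf, hff (f u)]
    simp
  have h2 (w : V) : f (f w) = s • (w - B ξ w • ξ) := by
    refine hφ ?_
    have e1 : B u (f (f w)) = s * B u w := by
      rw [← neg_inj, ← hf, ← neg_inj, neg_neg, ← hf, h1, map_smul]; simp
    have e2 : B (f u) (f (f w)) = s * B (f u) w := by
      rw [← neg_inj, ← hf, ← neg_inj, neg_neg, ← hf, h1, map_smul, map_smul]; simp
    simp only [φ, LinearMap.prod_apply, Function.prod_apply, map_smul, map_sub, e1, e2,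
      hξf, hξ, hs u ξ, hu, hs (f u) ξ]
    simp
  have h3 : f ∘ₗ f = s • (LinearMap.id - (B ξ).smulRight ξ) := LinearMap.ext h2
  have h4 : LinearMap.trace ℝ V (f ∘ₗ f) = s * 2 := by
    rw [h3, map_smul, map_sub, LinearMap.trace_id, LinearMap.trace_smulRight, hξ, hd, smul_eq_mul]
    norm_num
  rw [h2, h4]
  congr 1
  ring

end SkewEndomorphisms

/-! ### From the geometric structure to the algebraic one. -/

section KenmotsuStructure

variable {E : Type*} [NormedAddCommGroup E] [NormedSpace ℝ E]
  {M : Type*} [TopologicalSpace M] [ChartedSpace E M] [IsManifold 𝓘(ℝ, E) ∞ M]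

open SmoothField

namespace WeakAlmostContactMetricStructure

variable {n : ℕ} {g : SmoothMetric E M} (S : WeakAlmostContactMetricStructure n g)

/-- If fu = 0 then Qu = η(u)ξ = Q(η(u)ξ), and Q is injective. -/
theorem eq_smul_of_f_eq_zero {x : M} {u : TangentSpace 𝓘(ℝ, E) x} (h : S.f x u = 0) :
    u = S.η x u • S.ξ x := by
  have h1 := S.f_sq x u
  rw [h, map_zero] at h1
  refine (S.bijective_Q x).1 ?_
  rw [map_smul, S.Q_ξ]
  exact (neg_add_eq_zero.1 h1.symm)

/-- f²ξ = −Qξ + ξ = 0, so fξ = tξ for some t. Then t fξ = 0, and either factor being zero suffices.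
-/
theorem f_ξ (x : M) : S.f x (S.ξ x) = 0 := by
  have h1 : S.f x (S.f x (S.ξ x)) = 0 := by rw [S.f_sq, S.Q_ξ, S.η_ξ, one_smul, neg_add_cancel]
  have h2 := S.eq_smul_of_f_eq_zero h1
  rw [h2, map_smul, smul_eq_zero] at h1
  obtain h | h := h1
  · rw [h2, h, zero_smul]
  · exact h

theorem inner_ξ (x : M) (u : TangentSpace 𝓘(ℝ, E) x) : g.inner x (S.ξ x) u = S.η x u := by
  have h := S.inner_f x u (S.ξ x)
  rw [f_ξ, map_zero, S.Q_ξ, S.η_ξ, mul_one] at h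
  rw [g.symm]
  linarith

theorem η_f (x : M) (u : TangentSpace 𝓘(ℝ, E) x) : S.η x (S.f x u) = 0 := by
  have h := S.ker_invariant x (u - S.η x u • S.ξ x)
    (by rw [map_sub, map_smul, S.η_ξ, smul_eq_mul, mul_one, sub_self])
  rwa [map_sub, map_smul, f_ξ, smul_zero, sub_zero] at h

/-- The metric axiom gives skewness when the second argument lies in the image of f. As Q is onto
and Qw = −f²w + η(w)ξ, the remaining case is ξ, where both sides vanish. -/
theorem inner_f_left (x : M) (u v : TangentSpace 𝓘(ℝ, E) x) :
    g.inner x (S.f x u) v = -g.inner x u (S.f x v) := by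
  have h (v) : g.inner x (S.f x u) (S.f x v) = -g.inner x u (S.f x (S.f x v)) := by
    rw [S.inner_f, S.f_sq, map_add, map_neg, map_smul, g.symm x u (S.ξ x), inner_ξ, smul_eq_mul]
    ring
  obtain ⟨w, rfl⟩ := (S.bijective_Q x).2 v
  have hw : S.Q x w = -S.f x (S.f x w) + S.η x w • S.ξ x := by rw [S.f_sq]; abel
  rw [hw, map_add, map_add, map_neg, map_neg, map_smul, map_smul, f_ξ, h, g.symm x _ (S.ξ x),
    inner_ξ, η_f, map_add, map_neg]
  simp

end WeakAlmostContactMetricStructure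

variable [FiniteDimensional ℝ E]

namespace SmoothMetric

/-- The inner product on the tangent space at `x` as a bilinear form. -/
noncomputable def bilin (g : SmoothMetric E M) (x : M) :
    TangentSpace 𝓘(ℝ, E) x →ₗ[ℝ] TangentSpace 𝓘(ℝ, E) x →ₗ[ℝ] ℝ :=
  LinearMap.mk₂ ℝ (fun u v ↦ g.inner x u v)
    (fun u u' v ↦ by rw [map_add, _root_.add_apply])
    (fun c u v ↦ by rw [map_smul, _root_.smul_apply])
    (fun u v v' ↦ map_add _ _ _) (fun c u v ↦ map_smul _ _ _)

theorem scalarCurvature_eq (g : SmoothMetric E M) {x : M} {c : ℝ}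
    (h : ∀ u v, g.ricci x u v = c * g.inner x u v) :
    g.scalarCurvature x = c * Module.finrank ℝ E := by
  have : FiniteDimensional ℝ (TangentSpace 𝓘(ℝ, E) x) := inferInstanceAs (FiniteDimensional ℝ E)
  have h1 : g.ricciSharp x = c • LinearMap.id := by
    ext u
    apply (g.flat x).injective
    ext v
    rw [flat_apply, inner_ricciSharp, h, LinearMap.smul_apply, LinearMap.id_apply, map_smul,
      _root_.smul_apply, flat_apply, smul_eq_mul]
  rw [scalarCurvature, h1, map_smul, LinearMap.trace_id, smul_eq_mul]
  rfl

variable [T2Space M]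

theorem R_congr (g : SmoothMetric E M) {X X' Y Y' Z Z' : SmoothField E M} {x : M}
    (hX : X x = X' x) (hY : Y x = Y' x) (hZ : Z x = Z' x) :
    g.calculus.R X Y Z x = g.calculus.R X' Y' Z' x :=
  (apply_eq ((g.calculus.R.flip Y).flip Z) hX).trans
    ((apply_eq ((g.calculus.R X').flip Z) hY).trans (apply_eq (g.calculus.R X' Y') hZ))

theorem curvature_field (g : SmoothMetric E M) (X Y Z : SmoothField E M) (x : M) :
    g.curvature x (X x) (Y x) (Z x) = g.calculus.R X Y Z x := by
  rw [curvature_apply]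
  exact g.R_congr (ext_self _) (ext_self _) (ext_self _)

theorem ricci_field (g : SmoothMetric E M) (Y Z : SmoothField E M) (x : M) :
    g.ricci x (Y x) (Z x) = g.calculus.tr ((g.calculus.R.flip Y).flip Z) x := by
  refine congrArg (LinearMap.trace ℝ _) (LinearMap.ext fun w ↦ ?_)
  change g.curvature x w (Y x) (Z x) = g.calculus.R (ext w) Y Z x
  rw [← curvature_field, ext_self]

theorem lieDeriv_field (g : SmoothMetric E M) (V X Y : SmoothField E M) (x : M) :
    g.lieDeriv V x (X x) (Y x) = g.calculus.lieG V X Y x := by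
  have hs (u : TangentSpace 𝓘(ℝ, E) x) : MDiffAt (T% (localExt u)) x :=
    (contMDiffAt_localExt u).mdifferentiableAt (by simp)
  have hb (u : TangentSpace 𝓘(ℝ, E) x) := (CovariantDerivative.torsion_eq_zero_iff _).1
    g.leviCivita_torsion (mdiff V x) (hs u)
  change _ = g.inner x (g.leviCivita V x (X x)) (Y x) + g.inner x (X x) (g.leviCivita V x (Y x))
  rw [lieDeriv, ← hb, ← hb, g.leviCivita_metric (mdiff V x) (hs _) (hs _)]
  simp only [localExt_self, map_sub, _root_.sub_apply]
  ring

end SmoothMetric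

namespace WeakAlmostContactMetricStructure

variable {n : ℕ} {g : SmoothMetric E M} (S : WeakAlmostContactMetricStructure n g)

/-- The field `f` acting on smooth vector fields. -/
noncomputable def fEnd : SmoothField E M →ₗ[SmoothFun E M] SmoothField E M where
  toFun X := ⟨fun y ↦ S.f y (X y), fun y ↦
    ContMDiffAt.clm_bundle_apply (b := fun y : M ↦ y) (S.smooth_f y) (X.contMDiff y)⟩
  map_add' X Y := by
    ext y
    exact map_add (S.f y) (X y) (Y y)
  map_smul' c X := by
    ext y
    exact map_smul (S.f y) (c y) (X y)

variable [T2Space M]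

/-- The weak Kenmotsu structure on the smooth vector fields. -/
noncomputable def kenmotsu {β : ℝ} (hK : S.IsWeakKenmotsu β) :
    g.calculus.Kenmotsu (algebraMap ℝ (SmoothFun E M) β) where
  f := S.fEnd
  ξ := ⟨S.ξ, S.smooth_ξ⟩
  der_β X := by
    ext y
    change d% (fun _ : M ↦ β) y (X y) = 0
    rw [mvfderiv_const]
    rfl
  f_ξ := by
    ext y
    exact S.f_ξ y
  g_ξ_ξ := by
    ext y
    exact (S.inner_ξ y _).trans (S.η_ξ y)
  g_f X Y := by
    ext y
    exact S.inner_f_left y _ _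
  nabla_f X Y := by
    ext y
    have h := hK.2 y (X y) Y (mdiff Y y)
    rw [← S.inner_ξ] at h
    exact sub_eq_iff_eq_add'.1 h
  ker_f X h := by
    ext y
    have h := S.eq_smul_of_f_eq_zero (DFunLike.congr_fun h y)
    rw [← S.inner_ξ] at h
    exact h

theorem ricciStar_field (X Y : SmoothField E M) (x : M) :
    S.ricciStar x (X x) (Y x) =
      (1 / 2) * g.calculus.tr (S.fEnd ∘ₗ g.calculus.R X (S.fEnd Y)) x := by
  refine congrArg (fun T ↦ 1 / 2 * LinearMap.trace ℝ _ T) (LinearMap.ext fun w ↦ ?_)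
  change S.f x (g.curvature x (X x) (S.fEnd Y x) w) = S.f x (g.calculus.R X (S.fEnd Y) (ext w) x)
  rw [← SmoothMetric.curvature_field, ext_self]

end WeakAlmostContactMetricStructure

end KenmotsuStructure

/-! ### Vanishing of b and the conclusion. -/

section StarRicciSoliton

variable {E : Type*} [NormedAddCommGroup E] [NormedSpace ℝ E] [FiniteDimensional ℝ E]
  {M : Type*} [TopologicalSpace M] [ChartedSpace E M] [IsManifold 𝓘(ℝ, E) ∞ M] [T2Space M]

open SmoothField

instance : IsReduced (SmoothFun E M) where
  eq_zero a h := by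
    obtain ⟨k, hk⟩ := h
    ext y
    have h1 := congrArg (eval (E := E) y) hk
    rw [map_pow, map_zero] at h1
    exact eq_zero_of_pow_eq_zero h1

theorem SmoothMetric.tr_id (g : SmoothMetric E M) {n : ℕ}
    (hdim : Module.finrank ℝ E = 2 * n + 1) :
    g.calculus.tr LinearMap.id = 2 * (n : SmoothFun E M) + 1 := by
  ext y
  have h : (g.calculus.tr LinearMap.id) y = Module.finrank ℝ E := SmoothField.tr_id y
  rw [h, hdim]
  change _ = eval (E := E) y (2 * (n : SmoothFun E M) + 1)
  rw [map_add, map_mul, map_natCast, map_one, map_ofNat]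
  push_cast
  rfl

namespace RiemannianCalculus.Kenmotsu

variable {g : SmoothMetric E M} {β : SmoothFun E M} (K : g.calculus.Kenmotsu β)
  {b : SmoothFun E M} {V : SmoothField E M} {l m : SmoothFun E M} {n : ℕ}

/-- The kernel of `f` at each point is spanned by `ξ`. -/
def PointwiseKer : Prop := ∀ (x : M) (u : TangentSpace 𝓘(ℝ, E) x), endAt x K.f u = 0 →
  u = g.bilin x (K.ξ x) u • K.ξ x

theorem eq_zero_of_mul_g_f (hker : K.PointwiseKer) (hdim : 1 < Module.finrank ℝ E) (a : SmoothFun E M)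
    (h : ∀ X, a * g.calculus.g (K.f X) (K.f X) = 0) : a = 0 := by
  ext x
  obtain ⟨u, hu⟩ := exists_map_ne_zero_of_ker (V := TangentSpace 𝓘(ℝ, E) x) (B := g.bilin x)
    (hker x) hdim
  have h1 := DFunLike.congr_fun (h (ext u)) x
  exact (mul_eq_zero.1 h1).resolve_right (g.pos x _ hu).ne'

/-- θ∧Φ = 0 on (ξ, X, fX) reads θ(ξ)|fX|² = 0. -/
theorem θ_ξ (hker : K.PointwiseKer) (hdim : 1 < Module.finrank ℝ E) (hb : K.EtaEinstein b) : K.θ b K.ξ = 0 := by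
  refine K.eq_zero_of_mul_g_f hker hdim _ fun X ↦ ?_
  have h := K.θ_wedge hb K.ξ X (K.f X)
  rw [K.f_ξ, g_f_ξ, map_zero, LinearMap.zero_apply, mul_zero, mul_zero, add_zero, add_zero] at h
  exact h

theorem θ_eq_zero (hker : K.PointwiseKer) (hdim : 3 < Module.finrank ℝ E) (hb : K.EtaEinstein b) : K.θ b = 0 := by
  ext X x
  have h := eq_zero_of_wedge (V := TangentSpace 𝓘(ℝ, E) x) (B := g.bilin x) (f := endAt x K.f)
    (ξ := K.ξ x) (fun u hu ↦ g.inner_self_eq_zero hu) (hker x) hdim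
    (formAt x (K.θ b)) fun u v w ↦ by
      have h := DFunLike.congr_fun (K.θ_wedge hb (ext u) (ext v) (ext w)) x
      change _ * g.inner x (K.f (ext v) x) (ext w x) + _ * g.inner x (K.f (ext w) x) (ext u x) +
        _ * g.inner x (K.f (ext u) x) (ext v x) = 0 at h
      rw [ext_self, ext_self, ext_self] at h
      exact h
  rw [← formAt_apply, h]
  rfl

theorem conformal (hker : K.PointwiseKer) (hdim : Module.finrank ℝ E = 3) :
    K.Conformal (algebraMap ℝ (SmoothFun E M) (-(1 / 2)) * g.calculus.tr (K.f ∘ₗ K.f)) where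
  der_c X := by
    rw [Derivation.leibniz, K.der_tr_f_f, smul_zero, zero_add]
    have h : g.calculus.der X (algebraMap ℝ (SmoothFun E M) (-(1 / 2))) = 0 := by
      ext y
      change d% (fun _ : M ↦ (-(1 / 2) : ℝ)) y (X y) = 0
      rw [mvfderiv_const]
      rfl
    rw [h, smul_zero]
  f_f X := by
    ext x
    have hg (u v : TangentSpace 𝓘(ℝ, E) x) :
        g.bilin x (endAt x K.f u) v = -g.bilin x u (endAt x K.f v) := by
      have h := DFunLike.congr_fun (K.g_f (ext u) (ext v)) x
      change g.inner x (K.f (ext u) x) (ext v x) = -g.inner x (ext u x) (K.f (ext v) x) at h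
      rw [ext_self, ext_self] at h
      exact h
    have hξ : endAt x K.f (K.ξ x) = 0 :=
      (apply_eq K.f (ext_self _)).trans (DFunLike.congr_fun K.f_ξ x)
    have h := sq_eq_of_skew (V := TangentSpace 𝓘(ℝ, E) x) (B := g.bilin x) (f := endAt x K.f)
      (ξ := K.ξ x) (fun u hu ↦ g.inner_self_eq_zero hu) (fun u v ↦ g.symm x u v) hg
      (DFunLike.congr_fun K.g_ξ_ξ x) hξ (hker x) hdim (X x)
    have h1 : endAt x K.f (endAt x K.f (X x)) = K.f (K.f X) x :=
      (apply_eq K.f (ext_self _)).trans (apply_eq (K.f ∘ₗ K.f) (ext_self (X x)))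
    have h2 : endAt x K.f ∘ₗ endAt x K.f = endAt x (K.f ∘ₗ K.f) :=
      LinearMap.ext fun u ↦ apply_eq K.f (ext_self _)
    rw [h1, h2] at h
    rw [h]
    change _ = (-(-(1 / 2) * LinearMap.trace ℝ _ (endAt x (K.f ∘ₗ K.f)))) •
      (X x - g.inner x (K.ξ x) (X x) • K.ξ x)
    rw [neg_mul, neg_neg]
    rfl

theorem eq_zero_of_soliton (hker : K.PointwiseKer) (hn : n ≠ 0) (hdim : Module.finrank ℝ E = 2 * n + 1)
    (hb : K.EtaEinstein b) (S : K.Soliton b V l m) (hβ : IsUnit β) : b = 0 := by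
  have hf := K.eq_zero_of_mul_g_f hker (by lia)
  have hθ := K.θ_ξ hker (by lia) hb
  have htr := g.tr_id hdim
  -- At Y = ξ the b-term and both θ-terms of the trace identity vanish, leaving 4nβ²(l + m) = 0.
  have hs : l + m = 0 := by
    have h := S.tr_Rh_gradη hb hθ htr K.ξ
    rw [S.g_gradη_ξ, K.g_ξ_ξ, K.f_ξ, map_zero, map_zero, hθ] at h
    have h1 : ((4 * n : ℕ) : SmoothFun E M) * (β ^ 2 * (l + m)) = 0 := by
      push_cast
      linear_combination h
    exact (hβ.pow 2).mul_right_eq_zero.1 (g.calculus.natCast_cancel _ _ (by lia) h1)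
  have hG : b • K.gradη V = 0 := by
    by_cases h1 : n = 1
    · subst h1
      exact (K.conformal hker hdim).mul_gradη_eq_zero S hb hθ (by simpa using htr) hs hβ hf fun X h ↦ by
        ext y
        exact g.inner_self_eq_zero (DFunLike.congr_fun h y)
    -- In dimension at least five θ = 0, so the right side of the trace identity is zero.
    · refine g.calculus.g_ext _ _ fun Z ↦ ?_
      have h := S.tr_Rh_gradη hb hθ htr Z
      rw [hs, K.θ_eq_zero hker (by lia) hb] at h
      simp only [LinearMap.zero_apply] at h
      rw [map_smul, LinearMap.smul_apply, smul_eq_mul, map_zero, LinearMap.zero_apply]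
      linear_combination -h
  have h := hf _ fun X ↦ S.pow_mul_eq_zero hθ hs hG X
  have h2 : ((2 : ℕ) : SmoothFun E M) * (β * b ^ 3) = 0 := by
    push_cast
    linear_combination h
  have h3 := hβ.mul_right_eq_zero.1 (g.calculus.natCast_cancel _ _ two_ne_zero h2)
  exact pow_eq_zero_iff (three_ne_zero) |>.1 h3

end RiemannianCalculus.Kenmotsu

end StarRicciSoliton

theorem theorem2 {E : Type*} [NormedAddCommGroup E] [NormedSpace ℝ E] [FiniteDimensional ℝ E]
    {M : Type*} [TopologicalSpace M] [T2Space M] [SecondCountableTopology M]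
    [ChartedSpace E M] [IsManifold 𝓘(ℝ, E) ∞ M]
    (n : ℕ) (hdim : Module.finrank ℝ E = 2 * n + 1)
    (g : SmoothMetric E M) (S : WeakAlmostContactMetricStructure n g)
    (β : ℝ) (hK : S.IsWeakKenmotsu β) (hE : S.IsEtaEinstein)
    (V : VField E M) (l m : ℝ) (hV : S.IsStarEtaRicciSoliton V l m) :
    g.IsEinstein ∧
      ∀ x : M, g.scalarCurvature x = -2 * (n : ℝ) * (2 * (n : ℝ) + 1) * β ^ 2 := by
  obtain ⟨a', b', ha, hb, hab⟩ := hE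
  let a : SmoothFun E M := ⟨a', ha⟩
  let b : SmoothFun E M := ⟨b', hb⟩
  let W : SmoothField E M := ⟨V, hV.1⟩
  let K := S.kenmotsu hK
  have hker : K.PointwiseKer := fun x u hu ↦ by
    have h : S.f x (SmoothField.ext u x) = 0 := hu
    rw [SmoothField.ext_self] at h
    have h1 := S.eq_smul_of_f_eq_zero h
    rw [← S.inner_ξ] at h1
    exact h1
  have hR (Y Z : SmoothField E M) : g.calculus.tr ((g.calculus.R.flip Y).flip Z) =
      a * g.calculus.g Y Z + b * (g.calculus.g K.ξ Y * g.calculus.g K.ξ Z) := by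
    ext x
    have h := hab x (Y x) (Z x)
    rw [g.ricci_field, ← S.inner_ξ, ← S.inner_ξ] at h
    exact h
  have hsum := K.add_eq_of_etaEinstein (g.tr_id hdim) hR
  have hEin : K.EtaEinstein b := K.tr_Rh_of_etaEinstein (g.tr_id hdim) hR
  have hsum' (x : M) : a' x + b' x = -2 * n * β ^ 2 := by
    have h := congrArg (SmoothField.eval (E := E) x) hsum
    simp only [map_add, map_mul, map_neg, map_ofNat, map_natCast, map_pow] at h
    exact h
  have hder (c : ℝ) (X : SmoothField E M) :
      g.calculus.der X (algebraMap ℝ (SmoothFun E M) c) = 0 := by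
    ext y
    change d% (fun _ : M ↦ c) y (X y) = 0
    rw [mvfderiv_const]
    rfl
  have hsol : K.Soliton b W (algebraMap ℝ _ l) (algebraMap ℝ _ m) := by
    refine ⟨hder l, hder m, fun X Y ↦ ?_⟩
    ext x
    have h := hV.2 x (X x) (Y x)
    have h1 := congrArg (SmoothField.eval (E := E) x) (K.tr_f_R hEin X Y)
    have h2 : S.ricciStar x (X x) (Y x) =
      1 / 2 * SmoothField.eval x (g.calculus.tr (K.f ∘ₗ g.calculus.R X (K.f Y))) :=
        S.ricciStar_field X Y x
    have h3 : g.lieDeriv V x (X x) (Y x) = g.calculus.lieG W X Y x := g.lieDeriv_field W X Y x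
    rw [h2, h1, h3, ← S.inner_ξ, ← S.inner_ξ] at h
    have hg (Y Z : SmoothField E M) :
        SmoothField.eval (E := E) x (g.calculus.g Y Z) = g.inner x (Y x) (Z x) := rfl
    have hc (c : ℝ) : SmoothField.eval (E := E) x (algebraMap ℝ (SmoothFun E M) c) = c := rfl
    have hξ : K.ξ x = S.ξ x := rfl
    simp only [map_add, map_mul, map_neg, map_ofNat, map_pow, hg, hc] at h
    rw [← SmoothField.eval_apply, ← SmoothField.eval_apply]
    rw [← SmoothField.eval_apply] at h
    simp only [map_add, map_mul, map_ofNat, map_pow, hg, hc, hξ]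
    linear_combination 2 * h
  have hric (x : M) (u v : TangentSpace 𝓘(ℝ, E) x) :
      g.ricci x u v = (-2 * n * β ^ 2) * g.inner x u v := by
    -- For n = 0 each tangent space is spanned by the unit vector ξ, so η⊗η = g and b need not
    -- vanish; otherwise b = 0.
    have hbη : b' x * (S.η x u * S.η x v) = b' x * g.inner x u v := by
      by_cases hn : n = 0
      · have hone : Module.finrank ℝ (TangentSpace 𝓘(ℝ, E) x) = 1 := by
          rw [hn] at hdim
          exact hdim
        have hξ0 : S.ξ x ≠ 0 := fun h ↦ by
          have h1 := S.η_ξ x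
          rw [h, map_zero] at h1
          exact zero_ne_one h1
        obtain ⟨c, rfl⟩ := (finrank_eq_one_iff_of_nonzero' (S.ξ x) hξ0).1 hone u
        rw [map_smul, map_smul, _root_.smul_apply, S.inner_ξ, S.η_ξ, smul_eq_mul, smul_eq_mul,
          mul_one]
      · have hb0 : b = 0 := K.eq_zero_of_soliton hker hn hdim hEin hsol
          ((isUnit_iff_ne_zero.2 hK.1).map (algebraMap ℝ (SmoothFun E M)))
        have h0 : b' x = 0 := DFunLike.congr_fun hb0 x
        rw [h0, zero_mul, zero_mul]
    rw [hab, hbη, ← hsum']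
    ring
  refine ⟨⟨_, hric⟩, fun x ↦ ?_⟩
  rw [g.scalarCurvature_eq (hric x), hdim]
  push_cast
  ring
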